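/- Let $n,m\ge 1$. A star set in $\mathbb R^n$ is a set $L\ni o$ that every line through the origin $o$ meets in a (possibly degenerate) closed segment; its radial function is $\rho_L(u)=\max\{c\in\mathbb R: cu\in L\}$, $u\in S^{n-1}$. A star body is a star set whose radial function is continuous; $\mathcal S_0^n$ is the set of star bodies in $\mathbb R^n$. The radial sum $L\tilde+M$ is the star body with radial function $\rho_L+\rho_M$. Let $F$ be a real-valued function of $m$ star bodies in $\mathcal S_0^n$ which, in each argument separately, is additive with respect to $\tilde+$ and positively homogeneous ($F(\dots,cL,\dots)=c\,F(\dots,L,\dots)$ for $c>0$). Assume that at least one of the following holds: - (A) $F=F^+-F^-$, where $F^+$ and $F^-$ take values in $[0,\infty)$ and are separately additive and positively homogeneous; - (B) $F$ is separately bounded: for every $i$ and every choice of the arguments $L_j$, $j\ne i$, there is a constant $C$ with $|F(L_1,\dots,L_m)|\le C$ for all $L_i\in\mathcal S_0^n$ contained in the unit ball. Then the following are equivalent: 1. $F(L_1,\dots,L_m)=0$ whenever $L_i\cap L_j=\{o\}$ for some $i\neq j$; 2. $F$ is symmetric, and the associated polynomial $P_F(L)=F(L,\dots,L)$ satisfies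 $P_F(L\tilde+M)=P_F(L)+P_F(M)$ whenever $L\cap M=\{o\}$; 3. there is a finite signed regular Borel measure $\mu$ on $S^{n-1}$ such that $F(L_1,\dots,L_m)=\int_{S^{n-1}}\rho_{L_1}\cdots\rho_{L_m}\,d\mu$ for all $L_1,\dots,L_m$. Moreover, if $n\ge 2$, $F$ satisfies these equivalent conditions and $F$ is rotation invariant ($F(\phi L_1,\dots,\phi L_m)=F(L_1,\dots,L_m)$ for all $\phi\in SO(n)$), then there is a constant $c\in\mathbb R$ such that, for all $L_1,\dots,L_m$, $F(L_1,\dots,L_m)=c\cdot\frac1n\int_{S^{n-1}}\rho_{L_1}(u)\cdots\rho_{L_m}(u)\,du$. In particular, for $m=n$, $F=c\,\tilde V$, where $\tilde V(L_1,\dots,L_n)=\frac1n\int_{S^{n-1}}\rho_{L_1}(u)\cdots\rho_{L_n}(u)\,du$ is the dual mixed volume. -/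

import Mathlib

open MeasureTheory

/-- `n`-dimensional Euclidean space. -/
abbrev Euc (n : ℕ) : Type := EuclideanSpace ℝ (Fin n)

/-- The Euclidean unit sphere of `ℝⁿ`. -/
abbrev UnitSphere (n : ℕ) : Type := Metric.sphere (0 : Euc n) 1

/-- A star set: a set containing the origin that every line through the origin meets in a
(possibly degenerate) closed line segment. The line through `o` in the direction `u` is
parametrised by `c ↦ c • u`. -/
def IsStarSet {n : ℕ} (L : Set (Euc n)) : Prop :=
  (0 : Euc n) ∈ L ∧
    ∀ u : UnitSphere n, ∃ a b : ℝ, {c : ℝ | c • (u : Euc n) ∈ L} = Set.Icc a b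

/-- The radial function `ρ_L(u) = max {c : c u ∈ L}` on the unit sphere (for a star set the
supremum is attained). -/
noncomputable def radialFunction {n : ℕ} (L : Set (Euc n)) (u : UnitSphere n) : ℝ :=
  sSup {c : ℝ | c • (u : Euc n) ∈ L}

/-- A star body: a star set whose radial function is continuous. -/
structure StarBody (n : ℕ) where
  carrier : Set (Euc n)
  isStarSet : IsStarSet carrier
  continuous_radial : Continuous (radialFunction carrier)

/-- In a star set, the points on the ray through `u` are exactly those up to `ρ_L(u)`. -/
theorem IsStarSet.isGreatest {n : ℕ} {L : Set (Euc n)} (h : IsStarSet L) (u : UnitSphere n) :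
    IsGreatest {c : ℝ | c • (u : Euc n) ∈ L} (radialFunction L u) := by
  obtain ⟨a, b, hab⟩ := h.2 u
  have h0 : (0 : ℝ) ∈ {c : ℝ | c • (u : Euc n) ∈ L} := by simpa using h.1
  rw [radialFunction, hab]
  rw [hab] at h0
  rw [csSup_Icc (h0.1.trans h0.2)]
  exact isGreatest_Icc (h0.1.trans h0.2)

theorem IsStarSet.radialFunction_nonneg {n : ℕ} {L : Set (Euc n)} (h : IsStarSet L)
    (u : UnitSphere n) : 0 ≤ radialFunction L u :=
  (h.isGreatest u).2 (by simpa using h.1)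

namespace StarBody

variable {n : ℕ}

/-- The radial function of a star body. -/
noncomputable def radial (L : StarBody n) : UnitSphere n → ℝ := radialFunction L.carrier

theorem radial_nonneg (L : StarBody n) (u : UnitSphere n) : 0 ≤ L.radial u :=
  L.isStarSet.radialFunction_nonneg u

/-- The set `{r u : u ∈ S^{n-1}, 0 ≤ r ≤ f(u)} ∪ {o}`. -/
def radialSet (f : UnitSphere n → ℝ) : Set (Euc n) :=
  {x | x = 0 ∨ ∃ (u : UnitSphere n) (r : ℝ), 0 ≤ r ∧ r ≤ f u ∧ x = r • (u : Euc n)}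

theorem mem_radialSet_smul {f : UnitSphere n → ℝ} (hf : ∀ u, 0 ≤ f u) (u : UnitSphere n)
    (c : ℝ) : c • (u : Euc n) ∈ radialSet f ↔ -f (-u) ≤ c ∧ c ≤ f u := by
  have hu : ‖(u : Euc n)‖ = 1 := by simp
  have hu0 : (u : Euc n) ≠ 0 := by
    intro h; rw [h] at hu; simp at hu
  constructor
  · rintro (h | ⟨v, r, hr, hrf, h⟩)
    · have hc : c = 0 := by simpa [hu0] using h
      subst hc
      exact ⟨by simpa using hf (-u), hf u⟩
    · have hv : ‖(v : Euc n)‖ = 1 := by simp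
      have hn : |c| = r := by
        have := congrArg norm h
        rwa [norm_smul, norm_smul, hu, hv, mul_one, mul_one, Real.norm_eq_abs,
          Real.norm_eq_abs, abs_of_nonneg hr] at this
      rcases lt_trichotomy c 0 with hc | hc | hc
      · have hcr : r = -c := by rw [← hn, abs_of_neg hc]
        have hvu : v = -u := by
          apply Subtype.ext
          have h2 : c • ((u : Euc n) + v) = 0 := by
            rw [smul_add, h, hcr]; simp
          have h3 := (smul_eq_zero.1 h2).resolve_left hc.ne
          exact (neg_eq_of_add_eq_zero_right h3).symm
        rw [hvu] at hrf
        exact ⟨by linarith, hc.le.trans (hf u)⟩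
      · subst hc
        exact ⟨by simpa using hf (-u), hf u⟩
      · have hcr : r = c := by rw [← hn, abs_of_pos hc]
        have hvu : v = u := by
          apply Subtype.ext
          rw [hcr] at h
          exact (smul_right_injective _ hc.ne' h).symm
        rw [hvu] at hrf
        exact ⟨by linarith [hf (-u)], by linarith⟩
  · rintro ⟨h1, h2⟩
    rcases le_total 0 c with hc | hc
    · exact Or.inr ⟨u, c, hc, h2, rfl⟩
    · exact Or.inr ⟨-u, -c, by linarith, by linarith, by simp⟩

theorem radialFunction_radialSet {f : UnitSphere n → ℝ} (hf : ∀ u, 0 ≤ f u) :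
    radialFunction (radialSet f) = f := by
  funext u
  have : {c : ℝ | c • (u : Euc n) ∈ radialSet f} = Set.Icc (-f (-u)) (f u) := by
    ext c; exact mem_radialSet_smul hf u c
  rw [radialFunction, this, csSup_Icc]
  linarith [hf u, hf (-u)]

/-- The star body `L_f` whose radial function is a given nonnegative continuous function. -/
def ofRadial (f : UnitSphere n → ℝ) (hf : ∀ u, 0 ≤ f u) (hc : Continuous f) : StarBody n where
  carrier := radialSet f
  isStarSet := ⟨Or.inl rfl, fun u => ⟨-f (-u), f u, by ext c; exact mem_radialSet_smul hf u c⟩⟩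
  continuous_radial := by rw [radialFunction_radialSet hf]; exact hc

@[simp] theorem radial_ofRadial (f : UnitSphere n → ℝ) (hf : ∀ u, 0 ≤ f u)
    (hc : Continuous f) : (ofRadial f hf hc).radial = f :=
  radialFunction_radialSet hf

/-- A star body is determined by its radial function. -/
theorem radial_injective : Function.Injective (radial : StarBody n → UnitSphere n → ℝ) := by
  have key : ∀ L : StarBody n, L.carrier = radialSet L.radial := by
    intro L
    ext x
    by_cases hx : x = 0
    · subst hx; exact ⟨fun _ => Or.inl rfl, fun _ => L.isStarSet.1⟩
    · have hn : ‖x‖ ≠ 0 := norm_ne_zero_iff.2 hx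
      let u : UnitSphere n := ⟨‖x‖⁻¹ • x, by simp [norm_smul, hn]⟩
      have hxu : x = ‖x‖ • (u : Euc n) := by simp [u, smul_smul, hn]
      constructor
      · intro h
        refine Or.inr ⟨u, ‖x‖, norm_nonneg x, (L.isStarSet.isGreatest u).2 ?_, hxu⟩
        show ‖x‖ • (u : Euc n) ∈ L.carrier
        rw [← hxu]; exact h
      · rintro (h | ⟨v, r, hr, hrf, h⟩)
        · exact absurd h hx
        · rw [h]
          obtain ⟨a, b, hab⟩ := L.isStarSet.2 v
          have h0 : (0 : ℝ) ∈ {c : ℝ | c • (v : Euc n) ∈ L.carrier} := by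
            simpa using L.isStarSet.1
          have h1 := (L.isStarSet.isGreatest v).1
          have h2 : r ∈ {c : ℝ | c • (v : Euc n) ∈ L.carrier} := by
            rw [hab] at h0 h1 ⊢
            exact ⟨h0.1.trans hr, hrf.trans h1.2⟩
          exact h2
  intro L M h
  have hc : L.carrier = M.carrier := by rw [key L, key M, h]
  cases L; cases M; cases hc; rfl

/-- The radial sum: the star body with radial function `ρ_L + ρ_M`. -/
noncomputable def radialSum (L M : StarBody n) : StarBody n :=
  ofRadial (fun u => L.radial u + M.radial u)
    (fun u => add_nonneg (L.radial_nonneg u) (M.radial_nonneg u))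
    (L.continuous_radial.add M.continuous_radial)

theorem dilate_slice (L : StarBody n) {c : ℝ} (hc : 0 < c) (u : UnitSphere n) {a b : ℝ}
    (hab : {d : ℝ | d • (u : Euc n) ∈ L.carrier} = Set.Icc a b) :
    {d : ℝ | d • (u : Euc n) ∈ (fun x => c • x) '' L.carrier} = Set.Icc (c * a) (c * b) := by
  ext d
  have hd : d • (u : Euc n) ∈ (fun x => c • x) '' L.carrier ↔
      d / c ∈ {d : ℝ | d • (u : Euc n) ∈ L.carrier} := by
    constructor
    · rintro ⟨x, hx, hxd⟩
      have : (d / c) • (u : Euc n) = x := by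
        rw [div_eq_inv_mul, mul_smul, ← hxd, smul_smul, inv_mul_cancel₀ hc.ne', one_smul]
      show (d / c) • (u : Euc n) ∈ L.carrier
      rw [this]; exact hx
    · intro h
      exact ⟨_, h, by simp only [smul_smul]; rw [mul_div_cancel₀ _ hc.ne']⟩
  rw [Set.mem_ofPred_eq, hd, hab, Set.mem_Icc, Set.mem_Icc, le_div_iff₀ hc, div_le_iff₀ hc,
    mul_comm a, mul_comm b]

theorem radialFunction_dilate (L : StarBody n) {c : ℝ} (hc : 0 < c) :
    radialFunction ((fun x => c • x) '' L.carrier) = fun u => c * L.radial u := by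
  funext u
  obtain ⟨a, b, hab⟩ := L.isStarSet.2 u
  have h0 : (0 : ℝ) ∈ {d : ℝ | d • (u : Euc n) ∈ L.carrier} := by simpa using L.isStarSet.1
  rw [hab] at h0
  have hle := h0.1.trans h0.2
  rw [radialFunction, radial, radialFunction, L.dilate_slice hc u hab, hab, csSup_Icc hle,
    csSup_Icc (mul_le_mul_of_nonneg_left hle hc.le)]

/-- The dilate `c L = {c x : x ∈ L}`, `c > 0`. -/
def dilate (c : ℝ) (hc : 0 < c) (L : StarBody n) : StarBody n where
  carrier := (fun x => c • x) '' L.carrier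
  isStarSet := ⟨⟨0, L.isStarSet.1, smul_zero c⟩, fun u => by
    obtain ⟨a, b, hab⟩ := L.isStarSet.2 u
    exact ⟨c * a, c * b, L.dilate_slice hc u hab⟩⟩
  continuous_radial := by
    rw [L.radialFunction_dilate hc]
    exact continuous_const.mul L.continuous_radial

/-- The action of a linear isometry on the unit sphere. -/
noncomputable def sphereMap (φ : Euc n ≃ₗᵢ[ℝ] Euc n) (u : UnitSphere n) : UnitSphere n :=
  ⟨φ u, by simp⟩

theorem continuous_sphereMap (φ : Euc n ≃ₗᵢ[ℝ] Euc n) : Continuous (sphereMap φ) :=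
  (φ.continuous.comp continuous_subtype_val).subtype_mk _

theorem map_slice (φ : Euc n ≃ₗᵢ[ℝ] Euc n) (L : StarBody n) (u : UnitSphere n) :
    {c : ℝ | c • (u : Euc n) ∈ φ '' L.carrier} =
      {c : ℝ | c • (sphereMap φ.symm u : Euc n) ∈ L.carrier} := by
  ext c
  constructor
  · rintro ⟨x, hx, hxc⟩
    have : c • (sphereMap φ.symm u : Euc n) = x := by
      rw [← φ.symm_apply_apply x, hxc, map_smul]; rfl
    show c • (sphereMap φ.symm u : Euc n) ∈ L.carrier
    rw [this]; exact hx
  · intro h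
    exact ⟨_, h, by simp [sphereMap]⟩

theorem radialFunction_map (φ : Euc n ≃ₗᵢ[ℝ] Euc n) (L : StarBody n) :
    radialFunction (φ '' L.carrier) = fun u => L.radial (sphereMap φ.symm u) := by
  funext u
  rw [radialFunction, map_slice]
  rfl

/-- The image `φ L` of a star body under a linear isometry of `ℝⁿ`. -/
noncomputable def map (φ : Euc n ≃ₗᵢ[ℝ] Euc n) (L : StarBody n) : StarBody n where
  carrier := φ '' L.carrier
  isStarSet := ⟨⟨0, L.isStarSet.1, map_zero φ⟩, fun u => by
    rw [map_slice]; exact L.isStarSet.2 _⟩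
  continuous_radial := by
    rw [radialFunction_map]
    exact L.continuous_radial.comp (continuous_sphereMap φ.symm)

end StarBody

section Functionals

variable {n m : ℕ}

/-- `F` is additive with respect to the radial sum in each of its arguments. -/
def SeparatelyAdditive (F : (Fin m → StarBody n) → ℝ) : Prop :=
  ∀ (L : Fin m → StarBody n) (i : Fin m) (A B : StarBody n),
    F (Function.update L i (A.radialSum B)) =
      F (Function.update L i A) + F (Function.update L i B)

/-- `F` is positively homogeneous of degree one in each of its arguments. -/
def PositivelyHomogeneous (F : (Fin m → StarBody n) → ℝ) : Prop :=
  ∀ (L : Fin m → StarBody n) (i : Fin m) (A : StarBody n) (c : ℝ) (hc : 0 < c),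
    F (Function.update L i (A.dilate c hc)) = c * F (Function.update L i A)

/-- `F` is a difference of two nonnegative separately additive, positively homogeneous
functions. -/
def IsDifferenceOfNonneg (F : (Fin m → StarBody n) → ℝ) : Prop :=
  ∃ Fp Fm : (Fin m → StarBody n) → ℝ,
    (SeparatelyAdditive Fp ∧ PositivelyHomogeneous Fp ∧ ∀ L, 0 ≤ Fp L) ∧
    (SeparatelyAdditive Fm ∧ PositivelyHomogeneous Fm ∧ ∀ L, 0 ≤ Fm L) ∧
    ∀ L, F L = Fp L - Fm L

/-- `F` is separately bounded: with all arguments but the `i`-th fixed, `F` is bounded on the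
star bodies contained in the unit ball. -/
def SeparatelyBounded (F : (Fin m → StarBody n) → ℝ) : Prop :=
  ∀ (i : Fin m) (L : Fin m → StarBody n), ∃ C : ℝ, ∀ K : StarBody n,
    K.carrier ⊆ Metric.closedBall (0 : Euc n) 1 → |F (Function.update L i K)| ≤ C

/-- `F` vanishes whenever two of its arguments meet only at the origin. -/
def VanishesOnDisjoint (F : (Fin m → StarBody n) → ℝ) : Prop :=
  ∀ L : Fin m → StarBody n,
    (∃ i j : Fin m, i ≠ j ∧ (L i).carrier ∩ (L j).carrier = {0}) → F L = 0

/-- `F` is invariant under permutations of its arguments. -/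
def IsSymmetricFunctional (F : (Fin m → StarBody n) → ℝ) : Prop :=
  ∀ (σ : Equiv.Perm (Fin m)) (L : Fin m → StarBody n), F (fun i => L (σ i)) = F L

/-- The polynomial `P_F(L) = F(L, …, L)` associated with `F`. -/
def associatedPolynomial (F : (Fin m → StarBody n) → ℝ) (L : StarBody n) : ℝ :=
  F (fun _ => L)

/-- Additivity on radial sums of star bodies meeting only at the origin. -/
def IsOrthogonallyAdditive (P : StarBody n → ℝ) : Prop :=
  ∀ L M : StarBody n, L.carrier ∩ M.carrier = {0} → P (L.radialSum M) = P L + P M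

/-- `F(L₁, …, L_m) = ∫ ρ_{L₁} ⋯ ρ_{L_m} dμ` for a regular (signed, finite, countably additive)
Borel measure `μ` on the unit sphere. -/
def HasMeasureRepresentation (F : (Fin m → StarBody n) → ℝ) : Prop :=
  ∃ μ : SignedMeasure (UnitSphere n), μ.totalVariation.Regular ∧
    ∀ L : Fin m → StarBody n, F L = ∫ᵛ u, (∏ i, (L i).radial u) ∂<•μ

/-- `F` is invariant under simultaneous rotation of its arguments. -/
def IsRotationInvariant (F : (Fin m → StarBody n) → ℝ) : Prop :=
  ∀ φ : Euc n ≃ₗᵢ[ℝ] Euc n,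
    LinearMap.det (φ.toLinearEquiv : Euc n →ₗ[ℝ] Euc n) = 1 →
    ∀ L : Fin m → StarBody n, F (fun i => (L i).map φ) = F L

/-- `(1/n) ∫_{S^{n-1}} ρ_{L₁}(u) ⋯ ρ_{L_m}(u) du`, with `du` the spherical Lebesgue measure.
For `m = n` this is the dual mixed volume of `L₁, …, Lₙ`. -/
noncomputable def dualMixedVolume (L : Fin m → StarBody n) : ℝ :=
  (1 / (n : ℝ)) *
    ∫ u, ∏ i, (L i).radial u ∂((volume : Measure (Euc n)).toSphere)

end Functionals

open scoped NNReal

/-! Star bodies correspond to nonnegative continuous functions on the sphere, radial sum and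
dilation to sum and scaling, and meeting only at the origin to having zero product. So `F` becomes a
form `G`, multilinear over `ℝ≥0` on the cone of nonnegative functions (`radialForm`), and either of
(A), (B) makes `G` bounded on the functions `≤ 1` in each slot.

From vanishing to a measure: a bounded bilinear form `E` on `C(X)` that kills pairs with zero
product satisfies `E f g = E (f * g) 1` (`apply_eq_apply_mul_one_of_zero_product`). Joint
boundedness comes from Banach–Steinhaus. Applied to two slots at a time, this moves the product of
all arguments into one slot and leaves `1` in the others (`apply_eq_apply_update_prod`). What
remains is a bounded functional of one function, which the Riesz theorem represents by a difference
of two measures.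

From a measure to symmetry and orthogonal additivity: this is read off the integral.

From orthogonal additivity back to vanishing: Möbius inversion and symmetry kill `G` on arguments
that split into two mutually orthogonal groups (`apply_eq_zero_of_orthogonal_groups`). Cutting the
remaining arguments along level sets of a function reduces to this case when two arguments are
separated by a gap, and truncation at height `ε → 0` produces the gap
(`apply_eq_zero_of_mul_eq_zero`).

Rotation invariance: with unit balls in all slots but one, `F` determines the signed measure, which
is therefore rotation invariant. Averaging against tent functions `max 0 (ε - dist x y)` shows that
such a measure is a multiple of the spherical one (`exists_integral_sub_integral_eq_mul`). -/

theorem exists_continuous_rounding :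
    ∃ w p q : C(ℝ, ℝ), (∀ x, 0 ≤ w x ∧ w x ≤ 1) ∧ (∀ x, |x - p x| ≤ 1) ∧ (∀ x, |x - q x| ≤ 1) ∧
      (∀ x, w x ≠ 0 → ∃ k : ℤ, p x = k) ∧ (∀ x, 1 - w x ≠ 0 → ∃ k : ℤ, q x = k) := by
  -- No continuous function near the identity is integer valued everywhere, so two are used. With
  -- `t` the fractional part, `w` is supported in `t ≤ 1/3` or `t ≥ 2/3`, where `p` is the floor or
  -- the floor plus one. `1 - w` is supported in `1/6 ≤ t ≤ 5/6`, where `q` is the floor. The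
  -- corrections `r` and `s` agree at `t = 0` and `t = 1`, which gives continuity.
  let h : ℝ → ℝ := fun t => max 0 (min 1 (6 * |t - 1 / 2| - 1))
  let r : ℝ → ℝ := fun t => max 0 (min 1 (3 * t - 1)) - t
  let s : ℝ → ℝ := fun t => max 0 (6 * t - 5) - t
  have hh : Continuous (h ∘ Int.fract) :=
    ContinuousOn.comp_fract'' (by fun_prop) (by norm_num [h, abs_of_pos])
  have hr : Continuous (r ∘ Int.fract) :=
    ContinuousOn.comp_fract'' (by fun_prop) (by norm_num [r])
  have hs : Continuous (s ∘ Int.fract) :=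
    ContinuousOn.comp_fract'' (by fun_prop) (by norm_num [s])
  refine ⟨⟨_, hh⟩, ⟨_, continuous_id.add hr⟩, ⟨_, continuous_id.add hs⟩, fun x => ?_, fun x => ?_,
    fun x => ?_, fun x hx => ?_, fun x hx => ?_⟩
  · simp [h]
  · have h0 := Int.fract_nonneg x
    have h1 := (Int.fract_lt_one x).le
    simp only [ContinuousMap.coe_mk, id, r, Pi.add_apply, Function.comp_apply]
    rw [abs_le]
    constructor
    · have : max 0 (min 1 (3 * Int.fract x - 1)) ≤ 1 := by simp
      linarith
    · have : 0 ≤ max 0 (min 1 (3 * Int.fract x - 1)) := by simp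
      linarith
  · have h0 := Int.fract_nonneg x
    have h1 := (Int.fract_lt_one x).le
    simp only [ContinuousMap.coe_mk, id, s, Pi.add_apply, Function.comp_apply]
    rw [abs_le]
    constructor
    · have : max 0 (6 * Int.fract x - 5) ≤ 1 := max_le (by norm_num) (by linarith)
      linarith
    · have : 0 ≤ max 0 (6 * Int.fract x - 5) := le_max_left _ _
      linarith
  · have hfl := Int.floor_add_fract x
    have h2 : 1 / 6 < |Int.fract x - 1 / 2| := by
      by_contra hc
      exact hx (max_eq_left ((min_le_right _ _).trans (by linarith)))
    simp only [ContinuousMap.coe_mk, id, r, Pi.add_apply, Function.comp_apply]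
    rcases lt_abs.1 h2 with h3 | h3
    · refine ⟨⌊x⌋ + 1, ?_⟩
      rw [min_eq_left (by linarith), max_eq_right zero_le_one]
      push_cast
      linarith
    · refine ⟨⌊x⌋, ?_⟩
      rw [max_eq_left ((min_le_right _ _).trans (by linarith))]
      linarith
  · have hfl := Int.floor_add_fract x
    have h2 : |Int.fract x - 1 / 2| < 1 / 3 := by
      by_contra hc
      refine hx (sub_eq_zero.2 (Eq.symm ?_))
      change max 0 (min 1 (6 * |Int.fract x - 1 / 2| - 1)) = 1
      rw [min_eq_left (by linarith), max_eq_right zero_le_one]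
    simp only [ContinuousMap.coe_mk, id, s, Pi.add_apply, Function.comp_apply]
    refine ⟨⌊x⌋, ?_⟩
    rw [max_eq_left (by linarith [(abs_lt.1 h2).2])]
    linarith

/-! ### Bilinear forms on `C(X, ℝ)` that vanish on pairs with zero product -/

section Bilinear

variable {X : Type*} [TopologicalSpace X] [CompactSpace X]

/-- Where `u ≠ 0` the function `h` is an integer, so `hat k` is there the indicator of `h = k`, and
`u` is a finite sum of the pieces `u * hat k`. Each piece has zero product with `h - k`, so `h` may
be replaced by the constant `k`, which moves to the other slot by linearity. -/
theorem apply_eq_apply_mul_one_of_integer_valued (E : C(X, ℝ) →ₗ[ℝ] C(X, ℝ) →ₗ[ℝ] ℝ)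
    (h0 : ∀ f g, f * g = 0 → E f g = 0) (u h : C(X, ℝ))
    (hu : ∀ x, u x ≠ 0 → ∃ k : ℤ, h x = k) : E u h = E (u * h) 1 := by
  let hat : ℤ → C(X, ℝ) := fun k =>
    ⟨fun x => max 0 (1 - |h x - k|), by fun_prop⟩
  obtain ⟨M, hM⟩ := exists_nat_ge ‖h‖
  have hsum : u = ∑ k ∈ Finset.Icc (-(M : ℤ)) M, u * hat k := by
    ext x
    rw [← Finset.mul_sum, ContinuousMap.mul_apply, ContinuousMap.sum_apply]
    by_cases hx : u x = 0
    · simp [hx]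
    · obtain ⟨k, hk⟩ := hu x hx
      have hkM : |(k : ℝ)| ≤ M := by
        rw [← hk, ← Real.norm_eq_abs]; exact (h.norm_coe_le_norm x).trans hM
      have hkM' : |k| ≤ (M : ℤ) := by exact_mod_cast hkM
      rw [Finset.sum_eq_single k]
      · simp [hat, hk]
      · intro l _ hl
        have : (1 : ℝ) ≤ |h x - l| := by
          rw [hk]
          exact_mod_cast Int.one_le_abs (sub_ne_zero.2 hl.symm)
        exact max_eq_left (by linarith)
      · intro hk'
        exact absurd (Finset.mem_Icc.2 (abs_le.1 hkM')) hk'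
  have hterm : ∀ k : ℤ, E (u * hat k) h = E (u * hat k * h) 1 := by
    intro k
    have hz : u * hat k * (h - (k : ℝ) • 1) = 0 := by
      ext x
      by_cases hx : u x = 0
      · simp [hx]
      · obtain ⟨l, hl⟩ := hu x hx
        by_cases hlk : l = k
        · simp [hl, hlk]
        · have : (1 : ℝ) ≤ |h x - k| := by
            rw [hl]
            exact_mod_cast Int.one_le_abs (sub_ne_zero.2 hlk)
          have h2 : hat k x = 0 := max_eq_left (by linarith)
          simp [h2]
    have h1 := h0 _ _ hz
    rw [map_sub, sub_eq_zero] at h1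
    have h2 : u * hat k * h = (k : ℝ) • (u * hat k) := by
      rw [mul_sub, sub_eq_zero] at hz
      rw [hz, mul_smul_comm, mul_one]
    rw [h1, h2]
    simp
  conv_lhs => rw [hsum]
  conv_rhs => rw [hsum]
  rw [Finset.sum_mul, map_sum, map_sum, LinearMap.sum_apply, LinearMap.sum_apply]
  exact Finset.sum_congr rfl fun k _ => hterm k

/-- A bounded bilinear form on `C(X)` vanishing on pairs with zero product depends only on the
product of its arguments. -/
theorem apply_eq_apply_mul_one_of_zero_product (E : C(X, ℝ) →ₗ[ℝ] C(X, ℝ) →ₗ[ℝ] ℝ)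
    {C : ℝ} (hC : ∀ f g, |E f g| ≤ C * ‖f‖ * ‖g‖) (h0 : ∀ f g, f * g = 0 → E f g = 0)
    (f g : C(X, ℝ)) : E f g = E (f * g) 1 := by
  obtain ⟨w, p, q, hw, hp, hq, hpw, hqw⟩ := exists_continuous_rounding
  have hC' : ∀ f g, |E f g| ≤ |C| * ‖f‖ * ‖g‖ := fun f g =>
    (hC f g).trans (by gcongr; exact le_abs_self C)
  have hone : ‖(1 : C(X, ℝ))‖ ≤ 1 := (ContinuousMap.norm_le _ zero_le_one).2 fun x => by simp
  -- The defect `E u g - E (u * g) 1` is linear in `g` and vanishes at `g = h`, so it is controlled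
  -- by `g - h`. The bound does not involve the size of `g`.
  have step : ∀ u g h : C(X, ℝ), ‖u‖ ≤ ‖f‖ → ‖g - h‖ ≤ 1 →
      (∀ x, u x ≠ 0 → ∃ k : ℤ, h x = k) → |E u g - E (u * g) 1| ≤ 2 * (|C| * ‖f‖) := by
    intro u g h hu hgh hint
    have e := apply_eq_apply_mul_one_of_integer_valued E h0 u h hint
    have e2 : E u g - E (u * g) 1 = E u (g - h) - E (u * (g - h)) 1 := by
      rw [mul_sub, map_sub, map_sub, LinearMap.sub_apply, e]; ring
    have b1 : |E u (g - h)| ≤ |C| * ‖f‖ * 1 := (hC' _ _).trans (by gcongr)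
    have b2 : |E (u * (g - h)) 1| ≤ |C| * (‖f‖ * 1) * 1 :=
      (hC' _ _).trans (by gcongr; exact (norm_mul_le _ _).trans (by gcongr))
    rw [e2]
    exact (abs_sub _ _).trans (by linarith)
  have bound : ∀ g : C(X, ℝ), |E f g - E (f * g) 1| ≤ 4 * (|C| * ‖f‖) := by
    intro g
    have hle : ∀ v : C(X, ℝ), (∀ x, 0 ≤ v x ∧ v x ≤ 1) → ‖f * v‖ ≤ ‖f‖ := by
      intro v hv
      have : ‖v‖ ≤ 1 := (ContinuousMap.norm_le _ zero_le_one).2 fun x => by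
        rw [Real.norm_eq_abs, abs_of_nonneg (hv x).1]; exact (hv x).2
      calc ‖f * v‖ ≤ ‖f‖ * ‖v‖ := norm_mul_le _ _
        _ ≤ ‖f‖ * 1 := by gcongr
        _ = ‖f‖ := mul_one _
    have s1 := step (f * w.comp g) g (p.comp g) (hle _ fun x => hw _)
      ((ContinuousMap.norm_le _ zero_le_one).2 fun x => hp _)
      (fun x hx => hpw _ (right_ne_zero_of_mul hx))
    have s2 := step (f * (1 - w.comp g)) g (q.comp g)
      (hle _ fun x => by
        have := hw (g x)
        simp only [ContinuousMap.sub_apply, ContinuousMap.one_apply, ContinuousMap.comp_apply]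
        constructor <;> linarith)
      ((ContinuousMap.norm_le _ zero_le_one).2 fun x => hq _)
      (fun x hx => hqw _ (right_ne_zero_of_mul hx))
    have e : E f g - E (f * g) 1 = (E (f * w.comp g) g - E (f * w.comp g * g) 1) +
        (E (f * (1 - w.comp g)) g - E (f * (1 - w.comp g) * g) 1) := by
      have e1 : f * (1 - w.comp g) = f - f * w.comp g := by ring
      rw [e1, sub_mul, map_sub, map_sub, LinearMap.sub_apply, LinearMap.sub_apply]
      ring
    rw [e]
    exact (abs_add_le _ _).trans (by linarith)
  -- A linear functional of `g` that is bounded on the whole space is zero: replace `g` by a large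
  -- multiple `N • g`.
  by_contra hne
  obtain ⟨N, hN⟩ := exists_nat_gt (4 * (|C| * ‖f‖) / |E f g - E (f * g) 1|)
  have hpos : 0 < |E f g - E (f * g) 1| := abs_pos.2 (sub_ne_zero.2 hne)
  have b := bound ((N : ℝ) • g)
  rw [div_lt_iff₀ hpos] at hN
  rw [mul_smul_comm, map_smul, map_smul, LinearMap.smul_apply, ← smul_sub, smul_eq_mul, abs_mul,
    Nat.abs_cast] at b
  linarith

end Bilinear

/-! ### Extension from nonnegative functions to real functions -/

section Cone

variable {X : Type*} [TopologicalSpace X]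

/-- A nonnegative continuous function, regarded as a real-valued function. -/
def nnToReal (f : C(X, ℝ≥0)) : C(X, ℝ) := ⟨fun x => (f x : ℝ), by fun_prop⟩

@[simp] theorem nnToReal_apply (f : C(X, ℝ≥0)) (x : X) : nnToReal f x = (f x : ℝ) := rfl

/-- The positive part of a continuous function. -/
noncomputable def realToNN (f : C(X, ℝ)) : C(X, ℝ≥0) := ⟨fun x => (f x).toNNReal, by fun_prop⟩

@[simp] theorem realToNN_apply (f : C(X, ℝ)) (x : X) : realToNN f x = (f x).toNNReal := rfl

theorem nnToReal_sub_nnToReal_neg (f : C(X, ℝ)) :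
    nnToReal (realToNN f) - nnToReal (realToNN (-f)) = f := by
  ext x
  simp only [ContinuousMap.sub_apply, nnToReal_apply, realToNN_apply, ContinuousMap.neg_apply,
    Real.coe_toNNReal']
  exact max_zero_sub_eq_self (f x)

theorem nnToReal_mul (f g : C(X, ℝ≥0)) : nnToReal (f * g) = nnToReal f * nnToReal g := by
  ext x; simp

theorem nnToReal_add (f g : C(X, ℝ≥0)) : nnToReal (f + g) = nnToReal f + nnToReal g := by
  ext x; simp

theorem nnToReal_one : nnToReal (1 : C(X, ℝ≥0)) = 1 := by
  ext x; simp

theorem nnToReal_smul (c : ℝ≥0) (f : C(X, ℝ≥0)) : nnToReal (c • f) = (c : ℝ) • nnToReal f := by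
  ext x; simp

theorem realToNN_mul_eq_zero {f g : C(X, ℝ)} (h : f * g = 0) : realToNN f * realToNN g = 0 := by
  ext x
  have h1 : f x * g x = 0 := congrArg (fun k : C(X, ℝ) => k x) h
  rcases mul_eq_zero.1 h1 with h2 | h2 <;> simp [h2]

variable {V : Type*} [AddCommGroup V] [Module ℝ V]

/-- The linear extension to `C(X, ℝ)` of a map that is linear on the nonnegative functions. -/
noncomputable def coneExtend (φ : C(X, ℝ≥0) →ₗ[ℝ≥0] V) : C(X, ℝ) →ₗ[ℝ] V :=
  -- The value is the same for every decomposition of `f` as a difference of nonnegative functions.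
  -- Linearity then needs only a convenient decomposition.
  have key : ∀ (f : C(X, ℝ)) (a b : C(X, ℝ≥0)), f = nnToReal a - nnToReal b →
      φ (realToNN f) - φ (realToNN (-f)) = φ a - φ b := by
    intro f a b h
    have h1 : realToNN f + b = a + realToNN (-f) := by
      ext x
      have h2 := congrArg (fun g : C(X, ℝ) => g x) (nnToReal_sub_nnToReal_neg f)
      have h3 := congrArg (fun g : C(X, ℝ) => g x) h
      simp only [ContinuousMap.sub_apply, nnToReal_apply] at h2 h3
      simp only [ContinuousMap.add_apply, NNReal.coe_add]
      linarith
    rw [sub_eq_sub_iff_add_eq_add, ← map_add, ← map_add, h1]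
  { toFun := fun f => φ (realToNN f) - φ (realToNN (-f))
    map_add' := fun f g => by
      rw [key (f + g) (realToNN f + realToNN g) (realToNN (-f) + realToNN (-g)), map_add, map_add]
      · abel
      · rw [nnToReal_add, nnToReal_add, add_sub_add_comm, nnToReal_sub_nnToReal_neg,
          nnToReal_sub_nnToReal_neg]
    map_smul' := fun c f => by
      rcases le_total 0 c with hc | hc
      · lift c to ℝ≥0 using hc
        rw [key ((c : ℝ) • f) (c • realToNN f) (c • realToNN (-f)), map_smul, map_smul, ← smul_sub]
        · rfl
        · rw [nnToReal_smul, nnToReal_smul, ← smul_sub, nnToReal_sub_nnToReal_neg]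
      · obtain ⟨d, rfl⟩ : ∃ d : ℝ, c = -d := ⟨-c, by simp⟩
        lift d to ℝ≥0 using by linarith
        rw [key (-(d : ℝ) • f) (d • realToNN (-f)) (d • realToNN f), map_smul, map_smul, ← smul_sub,
          RingHom.id_apply, neg_smul, ← smul_neg, neg_sub]
        · rfl
        · rw [nnToReal_smul, nnToReal_smul, ← smul_sub, neg_smul, ← smul_neg,
            ← neg_sub (nnToReal (realToNN f)), nnToReal_sub_nnToReal_neg] }

theorem coneExtend_apply (φ : C(X, ℝ≥0) →ₗ[ℝ≥0] V) (f : C(X, ℝ)) :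
    coneExtend φ f = φ (realToNN f) - φ (realToNN (-f)) := rfl

@[simp] theorem coneExtend_nnToReal (φ : C(X, ℝ≥0) →ₗ[ℝ≥0] V) (f : C(X, ℝ≥0)) :
    coneExtend φ (nnToReal f) = φ f := by
  have h1 : realToNN (nnToReal f) = f := by ext x; simp
  have h2 : realToNN (-nnToReal f) = 0 := by ext x; simp
  rw [coneExtend_apply, h1, h2, map_zero, sub_zero]

theorem abs_apply_le_mul_of_le_smul_one {φ : C(X, ℝ≥0) →ₗ[ℝ≥0] ℝ} {C : ℝ}
    (hC : ∀ f ≤ 1, |φ f| ≤ C) {c : ℝ≥0} {f : C(X, ℝ≥0)} (hf : f ≤ c • 1) : |φ f| ≤ C * c := by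
  rcases eq_or_ne c 0 with rfl | hc
  · have : f = 0 := by
      refine le_antisymm ?_ (fun x => zero_le)
      simpa using hf
    simp [this]
  · have h1 : c⁻¹ • f ≤ 1 := by
      intro x
      have : f x ≤ c • (1 : ℝ≥0) := hf x
      rw [smul_eq_mul, mul_one] at this
      change c⁻¹ * f x ≤ 1
      exact (inv_mul_le_one₀ (pos_iff_ne_zero.2 hc)).2 this
    have h2 := hC _ h1
    rw [map_smul, NNReal.smul_def, smul_eq_mul, abs_mul, NNReal.abs_eq, NNReal.coe_inv] at h2
    rwa [inv_mul_le_iff₀ (by positivity), mul_comm] at h2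

end Cone

/-! ### Bilinear forms on the cone of nonnegative functions -/

section ConeBilinear

variable {X : Type*} [TopologicalSpace X] [CompactSpace X]

theorem realToNN_le_smul_one {f : C(X, ℝ)} {c : ℝ≥0} (hf : ‖f‖ ≤ c) :
    realToNN f ≤ c • (1 : C(X, ℝ≥0)) := by
  intro x
  change (f x).toNNReal ≤ c • (1 : ℝ≥0)
  rw [smul_eq_mul, mul_one]
  exact Real.toNNReal_le_iff_le_coe.2 ((le_abs_self _).trans ((f.norm_coe_le_norm x).trans hf))

theorem abs_coneExtend_le {φ : C(X, ℝ≥0) →ₗ[ℝ≥0] ℝ} {C : ℝ} (hC : ∀ f ≤ 1, |φ f| ≤ C)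
    (f : C(X, ℝ)) : |coneExtend φ f| ≤ 2 * C * ‖f‖ := by
  have h1 := abs_apply_le_mul_of_le_smul_one hC (realToNN_le_smul_one (f := f) (c := ‖f‖₊) le_rfl)
  have h2 := abs_apply_le_mul_of_le_smul_one hC
    (realToNN_le_smul_one (f := -f) (c := ‖f‖₊) (by simp))
  rw [coe_nnnorm] at h1 h2
  rw [coneExtend_apply]
  exact (abs_sub _ _).trans (by linarith)

/-- Banach–Steinhaus for separately bounded bilinear forms. -/
theorem exists_bound_of_separately_bounded {V W : Type*} [NormedAddCommGroup V] [NormedSpace ℝ V]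
    [NormedAddCommGroup W] [NormedSpace ℝ W] [CompleteSpace W]
    (E : V →ₗ[ℝ] W →ₗ[ℝ] ℝ) (h1 : ∀ f, ∃ C, ∀ g, |E f g| ≤ C * ‖g‖)
    (h2 : ∀ g, ∃ C, ∀ f, |E f g| ≤ C * ‖f‖) : ∃ C, ∀ f g, |E f g| ≤ C * ‖f‖ * ‖g‖ := by
  choose C1 hC1 using h1
  choose C2 hC2 using h2
  -- The family is indexed by the unit ball of `V`; `h2` is its pointwise boundedness, so
  -- completeness is needed for `W` only.
  let T : {f : V // ‖f‖ ≤ 1} → W →L[ℝ] ℝ := fun f => (E f).mkContinuous (C1 f) (hC1 f)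
  obtain ⟨C, hC⟩ := banach_steinhaus (g := T) fun g => ⟨|C2 g|, fun f =>
    (hC2 g f).trans ((mul_le_mul_of_nonneg_right (le_abs_self _) (norm_nonneg _)).trans
      (mul_le_of_le_one_right (abs_nonneg _) f.2))⟩
  refine ⟨C, fun f g => ?_⟩
  rcases eq_or_ne f 0 with rfl | hf
  · simp
  · have hf' : ‖f‖ ≠ 0 := norm_ne_zero_iff.2 hf
    have hn : ‖(‖f‖⁻¹ : ℝ) • f‖ ≤ 1 := by simp [norm_smul, hf']
    have := (T ⟨_, hn⟩).le_of_opNorm_le (hC ⟨_, hn⟩) g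
    change |E (‖f‖⁻¹ • f) g| ≤ C * ‖g‖ at this
    rw [map_smul, LinearMap.smul_apply, smul_eq_mul, abs_mul, abs_inv, abs_norm,
      inv_mul_le_iff₀ (by positivity)] at this
    linarith

/-- A separately bounded biadditive form on the nonnegative continuous functions that vanishes on
pairs with zero product depends only on the product of its arguments. -/
theorem cone_apply_eq_apply_mul_one (B : C(X, ℝ≥0) →ₗ[ℝ≥0] C(X, ℝ≥0) →ₗ[ℝ≥0] ℝ)
    (h1 : ∀ f, ∃ C, ∀ g ≤ 1, |B f g| ≤ C) (h2 : ∀ g, ∃ C, ∀ f ≤ 1, |B f g| ≤ C)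
    (h0 : ∀ f g, f * g = 0 → B f g = 0) (f g : C(X, ℝ≥0)) : B f g = B (f * g) 1 := by
  -- The extension is done in one variable at a time: `T` extends the second, and `E` then extends
  -- the first, with values in a space of linear maps.
  let T : C(X, ℝ≥0) →ₗ[ℝ≥0] C(X, ℝ) →ₗ[ℝ] ℝ :=
    { toFun := fun f => coneExtend (B f)
      map_add' := fun f g => by
        ext k; simp only [coneExtend_apply, map_add, LinearMap.add_apply]; ring
      map_smul' := fun c f => by
        ext k
        simp only [coneExtend_apply, map_smul, LinearMap.smul_apply, smul_sub, RingHom.id_apply] }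
  let E := coneExtend T
  have hE : ∀ f g, E f g = (B (realToNN f) (realToNN g) - B (realToNN f) (realToNN (-g))) -
      (B (realToNN (-f)) (realToNN g) - B (realToNN (-f)) (realToNN (-g))) := fun f g => rfl
  have hE1 : ∀ f, ∃ C, ∀ g, |E f g| ≤ C * ‖g‖ := by
    intro f
    obtain ⟨C, hC⟩ := h1 (realToNN f)
    obtain ⟨D, hD⟩ := h1 (realToNN (-f))
    refine ⟨2 * C + 2 * D, fun g => ?_⟩
    have a := abs_coneExtend_le hC g
    have b := abs_coneExtend_le hD g
    rw [add_mul]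
    exact (abs_sub _ _).trans (add_le_add a b)
  have hE2 : ∀ g, ∃ C, ∀ f, |E f g| ≤ C * ‖f‖ := by
    intro g
    obtain ⟨C, hC⟩ := h2 (realToNN g)
    obtain ⟨D, hD⟩ := h2 (realToNN (-g))
    refine ⟨2 * C + 2 * D, fun f => ?_⟩
    have a := abs_coneExtend_le (φ := B.flip (realToNN g)) hC f
    have b := abs_coneExtend_le (φ := B.flip (realToNN (-g))) hD f
    simp only [coneExtend_apply, LinearMap.flip_apply] at a b
    rw [hE, sub_sub_sub_comm]
    exact (abs_sub _ _).trans (by linarith)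
  have hE0 : ∀ f g, f * g = 0 → E f g = 0 := by
    intro f g hfg
    rw [hE, h0 _ _ (realToNN_mul_eq_zero hfg), h0 _ _ (realToNN_mul_eq_zero (by simp [hfg])),
      h0 _ _ (realToNN_mul_eq_zero (by simp [hfg])), h0 _ _ (realToNN_mul_eq_zero (by simp [hfg]))]
    simp
  obtain ⟨C, hC⟩ := exists_bound_of_separately_bounded E hE1 hE2
  have key := apply_eq_apply_mul_one_of_zero_product E hC hE0 (nnToReal f) (nnToReal g)
  rw [← nnToReal_mul, ← nnToReal_one] at key
  simpa [E, T] using key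

end ConeBilinear

/-! ### Multilinear forms: collecting the product in one slot, and orthogonal additivity -/

section Multilinear

variable {X : Type*} [TopologicalSpace X] {ι : Type*} [DecidableEq ι]

theorem apply_eq_apply_update_mul_one [CompactSpace X]
    (G : MultilinearMap ℝ≥0 (fun _ : ι => C(X, ℝ≥0)) ℝ)
    (hb : ∀ x i, ∃ C, ∀ f ≤ 1, |G (Function.update x i f)| ≤ C)
    (hv : ∀ x, (∃ i j, i ≠ j ∧ x i * x j = 0) → G x = 0) (x : ι → C(X, ℝ≥0)) {i j : ι}
    (hij : i ≠ j) :
    G x = G (Function.update (Function.update x i (x i * x j)) j 1) := by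
  let B : C(X, ℝ≥0) →ₗ[ℝ≥0] C(X, ℝ≥0) →ₗ[ℝ≥0] ℝ :=
    LinearMap.mk₂ ℝ≥0 (fun f g => G (Function.update (Function.update x i f) j g))
      (fun f f' g => by
        rw [Function.update_comm hij, Function.update_comm hij, Function.update_comm hij,
          G.map_update_add])
      (fun c f g => by
        rw [Function.update_comm hij, Function.update_comm hij, G.map_update_smul])
      (fun f g g' => by rw [G.map_update_add])
      (fun c f g => by rw [G.map_update_smul])
  have key := cone_apply_eq_apply_mul_one B (fun f => hb (Function.update x i f) j)
    (fun g => by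
      obtain ⟨C, hC⟩ := hb (Function.update x j g) i
      refine ⟨C, fun f hf => ?_⟩
      have := hC f hf
      rwa [Function.update_comm hij.symm] at this)
    (fun f g hfg => hv _ ⟨i, j, hij, by simp [hij, hfg]⟩) (x i) (x j)
  simpa [B] using key

/-- A separately bounded multilinear form on the nonnegative continuous functions that vanishes
when two arguments have zero product depends only on the product of its arguments. -/
theorem apply_eq_apply_update_prod [CompactSpace X] [Fintype ι]
    (G : MultilinearMap ℝ≥0 (fun _ : ι => C(X, ℝ≥0)) ℝ)
    (hb : ∀ x i, ∃ C, ∀ f ≤ 1, |G (Function.update x i f)| ≤ C)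
    (hv : ∀ x, (∃ i j, i ≠ j ∧ x i * x j = 0) → G x = 0) (x : ι → C(X, ℝ≥0)) (i : ι) :
    G x = G (Function.update 1 i (∏ k, x k)) := by
  -- The slots in `s` have already been emptied to `1` and their contents multiplied into slot `i`.
  have key : ∀ s : Finset ι, i ∉ s →
      G x = G (Function.update (s.piecewise 1 x) i (x i * ∏ k ∈ s, x k)) := by
    intro s
    induction s using Finset.induction_on with
    | empty => intro _; simp
    | insert j s hj ih =>
      intro hi
      rw [Finset.mem_insert, not_or] at hi
      rw [ih hi.2, apply_eq_apply_update_mul_one G hb hv _ hi.1, Finset.prod_insert hj]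
      congr 1
      ext1 k
      by_cases hkj : k = j
      · subst hkj
        simp [Ne.symm hi.1]
      · by_cases hki : k = i
        · subst hki
          rw [Function.update_of_ne hkj]
          simp [Function.update_of_ne (Ne.symm hi.1), hj, mul_comm, mul_left_comm]
        · simp [hkj, hki, Finset.piecewise, Finset.mem_insert]
  rw [key (Finset.univ.erase i) (by simp), Finset.mul_prod_erase _ _ (Finset.mem_univ i)]
  congr 1
  ext1 k
  by_cases hki : k = i
  · subst hki; simp
  · simp [hki]

/-- Uniqueness in Möbius inversion on the subset lattice: by strong induction all proper subsets
contribute zero. It extracts a single coefficient from identities over all subsets. -/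
theorem eq_zero_of_forall_sum_powerset_eq_zero {α M : Type*} [DecidableEq α] [AddCommMonoid M]
    (h : Finset α → M) (H : ∀ s : Finset α, ∑ t ∈ s.powerset, h t = 0) (s : Finset α) :
    h s = 0 := by
  induction s using Finset.strongInduction with
  | H s ih =>
    have h1 := H s
    rwa [← Finset.sum_erase_add _ _ (Finset.mem_powerset_self s),
      Finset.sum_eq_zero (fun t ht => ih t ?_), zero_add] at h1
    rw [Finset.mem_erase, Finset.mem_powerset] at ht
    exact lt_of_le_of_ne ht.2 ht.1

variable [Fintype ι]

/-- If the polynomial of a symmetric multilinear form is additive on pairs with zero product, then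
the form vanishes whenever its arguments split into two mutually orthogonal nonempty groups. -/
theorem apply_eq_zero_of_orthogonal_groups
    (G : MultilinearMap ℝ≥0 (fun _ : ι => C(X, ℝ≥0)) ℝ)
    (hsym : ∀ (σ : Equiv.Perm ι) x, G (fun i => x (σ i)) = G x)
    (hadd : ∀ f g : C(X, ℝ≥0), f * g = 0 → G (fun _ => f + g) = G (fun _ => f) + G (fun _ => g))
    (x : ι → C(X, ℝ≥0)) (A : Finset ι) {a b : ι} (ha : a ∈ A) (hb : b ∉ A)
    (hx : ∀ i ∈ A, ∀ j ∉ A, x i * x j = 0) : G x = 0 := by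
  classical
  have expand : ∀ S : Finset ι, G (fun _ => ∑ j ∈ S, x j) =
      ∑ c : ι → ι, if ∀ k, c k ∈ S then G (fun k => x (c k)) else 0 := by
    intro S
    rw [G.map_sum_finset (fun _ j => x j) (fun _ => S), ← Finset.sum_filter]
    refine Finset.sum_congr ?_ fun _ _ => rfl
    ext c
    simp
  -- `H c` retains the mixed terms only: those whose indices meet both `A` and its complement.
  let H : (ι → ι) → ℝ := fun c =>
    (1 - (if ∀ k, c k ∈ A then 1 else 0) - (if ∀ k, c k ∈ Aᶜ then 1 else 0)) * G (fun k => x (c k))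
  -- This is additivity of the polynomial at the two orthogonal sums over `S ∩ A` and `S ∩ Aᶜ`,
  -- expanded by multilinearity.
  have hH : ∀ S : Finset ι, ∑ c : ι → ι, (if ∀ k, c k ∈ S then H c else 0) = 0 := by
    intro S
    have h1 : (∑ j ∈ S ∩ A, x j) * (∑ j ∈ S ∩ Aᶜ, x j) = 0 := by
      rw [Finset.sum_mul_sum]
      refine Finset.sum_eq_zero fun i hi => Finset.sum_eq_zero fun j hj => hx i ?_ j ?_
      · exact (Finset.mem_inter.1 hi).2
      · exact Finset.mem_compl.1 (Finset.mem_inter.1 hj).2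
    have h2 : ∑ j ∈ S, x j = ∑ j ∈ S ∩ A, x j + ∑ j ∈ S ∩ Aᶜ, x j := by
      rw [← Finset.sum_inter_add_sum_sdiff S A, Finset.sdiff_eq_inter_compl]
    have h3 := hadd _ _ h1
    rw [← h2, expand, expand, expand, ← Finset.sum_add_distrib, ← sub_eq_zero,
      ← Finset.sum_sub_distrib] at h3
    refine (Finset.sum_congr rfl fun c _ => ?_).trans h3
    have e1 : (∀ k, c k ∈ S ∩ A) ↔ (∀ k, c k ∈ S) ∧ ∀ k, c k ∈ A := by
      simp only [Finset.mem_inter]; exact forall_and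
    have e2 : (∀ k, c k ∈ S ∩ Aᶜ) ↔ (∀ k, c k ∈ S) ∧ ∀ k, c k ∈ Aᶜ := by
      simp only [Finset.mem_inter]; exact forall_and
    simp only [H, e1, e2]
    by_cases p : ∀ k, c k ∈ S <;> by_cases q : ∀ k, c k ∈ A <;> by_cases r : ∀ k, c k ∈ Aᶜ <;>
      simp only [p, q, r, and_self, and_true, and_false, if_true, if_false, implies_true] <;> ring
  -- Grouping the index maps by their image and inverting over `S` isolates the maps onto `ι`. These
  -- are the permutations; all of them are mixed because of `a` and `b`, and each contributes `G x`
  -- by symmetry. So a positive multiple of `G x` is zero.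
  have hM := eq_zero_of_forall_sum_powerset_eq_zero
    (fun T : Finset ι => ∑ c : ι → ι, if Finset.univ.image c = T then H c else 0)
    (fun S => by
      rw [Finset.sum_comm]
      refine (Finset.sum_congr rfl fun c _ => ?_).trans (hH S)
      rw [Finset.sum_ite_eq]
      simp [Finset.image_subset_iff]) Finset.univ
  have hbij : ∀ c : ι → ι, (if Finset.univ.image c = Finset.univ then H c else 0) =
      if Function.Bijective c then G x else 0 := by
    intro c
    have e : Finset.univ.image c = Finset.univ ↔ Function.Bijective c := by
      rw [← Finite.surjective_iff_bijective, Finset.eq_univ_iff_forall]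
      simp [Function.Surjective]
    simp only [e]
    split_ifs with hc
    · have q : ¬ ∀ k, c k ∈ A := fun h => by
        obtain ⟨k, hk⟩ := hc.2 b
        exact hb (hk ▸ h k)
      have r : ¬ ∀ k, c k ∈ Aᶜ := fun h => by
        obtain ⟨k, hk⟩ := hc.2 a
        exact Finset.mem_compl.1 (h k) (hk ▸ ha)
      simp only [H, q, r, if_false, sub_zero, one_mul]
      exact hsym (Equiv.ofBijective c hc) x
    · rfl
  simp only [hbij] at hM
  rw [← Finset.sum_filter, Finset.sum_const, smul_eq_zero] at hM
  refine hM.resolve_left fun h => ?_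
  rw [Finset.card_eq_zero] at h
  have : id ∈ Finset.univ.filter (Function.Bijective (α := ι) (β := ι)) := by
    simp
  rw [h] at this
  simp at this

-- `R` is the set of slots with no support condition. Induction removes a slot from `R` by cutting
-- its function into a part at low and a part at high values of `h`; each part joins one of the two
-- groups, at the price of a narrower gap. When `R` is empty the groups are orthogonal.
omit [Fintype ι] in
theorem apply_eq_zero_of_separated
    (G : MultilinearMap ℝ≥0 (fun _ : ι => C(X, ℝ≥0)) ℝ)
    (horth : ∀ (x : ι → C(X, ℝ≥0)) (A : Finset ι) (a b : ι), a ∈ A → b ∉ A →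
      (∀ i ∈ A, ∀ j ∉ A, x i * x j = 0) → G x = 0)
    (h : C(X, ℝ)) {a b : ι} (R : Finset ι) : ∀ (s t : ℝ) (x : ι → C(X, ℝ≥0)) (A : Finset ι),
      s < t → a ∈ A → a ∉ R → b ∉ A → b ∉ R →
      (∀ i ∈ A, i ∉ R → ∀ u, x i u ≠ 0 → h u ≤ s) →
      (∀ i ∉ A, i ∉ R → ∀ u, x i u ≠ 0 → t ≤ h u) → G x = 0 := by
  induction R using Finset.induction_on with
  | empty =>
    intro s t x A hst ha _ hb _ hA hB
    refine horth x A a b ha hb fun i hi j hj => ?_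
    ext u
    by_contra hne
    have h1 : x i u * x j u ≠ 0 := fun h => hne (by simp [h])
    have h2 := hA i hi (by simp) u (left_ne_zero_of_mul h1)
    have h3 := hB j hj (by simp) u (right_ne_zero_of_mul h1)
    linarith
  | insert r R hr ih =>
    intro s t x A hst ha haR hb hbR hA hB
    rw [Finset.mem_insert, not_or] at haR hbR
    obtain ⟨s', hs, hst'⟩ := exists_between hst
    obtain ⟨t', hs', ht⟩ := exists_between hst'
    -- `φ` is `1` where `h ≤ s'` and `0` where `h ≥ t'`. Hence `x r * φ` lives in `h ≤ t'` and joins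
    -- `A`, with gap from `t'` to `t`; `x r * (1 - φ)` lives in `h ≥ s'` and joins the complement,
    -- with gap from `s` to `s'`.
    let φ : C(X, ℝ) := ⟨fun u => min 1 (max 0 ((t' - h u) / (t' - s'))), by fun_prop⟩
    have hφ : realToNN φ + realToNN (1 - φ) = 1 := by
      ext u
      have h0 : 0 ≤ φ u := le_min zero_le_one (le_max_left _ _)
      have h1 : 0 ≤ 1 - φ u := sub_nonneg.2 (min_le_left _ _)
      simp [h0, h1]
    have hx : G x = G (Function.update x r (x r * realToNN φ)) +
        G (Function.update x r (x r * realToNN (1 - φ))) := by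
      rw [← G.map_update_add, ← mul_add, hφ, mul_one, Function.update_eq_self]
    rw [hx, ih t' t _ (insert r A) ht, ih s s' _ (A.erase r) hs, add_zero]
    · exact Finset.mem_erase.2 ⟨haR.1, ha⟩
    · exact haR.2
    · exact fun h => hb (Finset.mem_of_mem_erase h)
    · exact hbR.2
    · intro i hi hiR u hu
      have hi' := Finset.mem_erase.1 hi
      rw [Function.update_of_ne hi'.1] at hu
      exact hA i hi'.2 (by simp [hi'.1, hiR]) u hu
    · intro i hi hiR u hu
      by_cases hir : i = r
      · subst hir
        rw [Function.update_self, ContinuousMap.mul_apply] at hu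
        have hu := right_ne_zero_of_mul hu
        by_contra hlt
        refine hu ?_
        have h1 : 1 ≤ (t' - h u) / (t' - s') := by
          rw [one_le_div (by linarith)]; linarith
        have h2 : φ u = 1 := min_eq_left (h1.trans (le_max_right _ _))
        simp [h2]
      · rw [Function.update_of_ne hir] at hu
        have := hB i (fun h => hi (Finset.mem_erase.2 ⟨hir, h⟩)) (by simp [hir, hiR]) u hu
        linarith
    · exact Finset.mem_insert_of_mem ha
    · exact haR.2
    · simp [hb, hbR.1]
    · exact hbR.2
    · intro i hi hiR u hu
      by_cases hir : i = r
      · subst hir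
        rw [Function.update_self, ContinuousMap.mul_apply] at hu
        have hu := right_ne_zero_of_mul hu
        by_contra hlt
        refine hu ?_
        have h1 : (t' - h u) / (t' - s') ≤ 0 :=
          div_nonpos_of_nonpos_of_nonneg (by linarith) (by linarith)
        have h2 : φ u = 0 := by simp [φ, max_eq_left h1]
        simp [h2]
      · rw [Function.update_of_ne hir] at hu
        have := hA i (Finset.mem_of_mem_insert_of_ne hi hir) (by simp [hir, hiR]) u hu
        linarith
    · intro i hi hiR u hu
      rw [Finset.mem_insert, not_or] at hi
      rw [Function.update_of_ne hi.1] at hu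
      exact hB i hi.2 (by simp [hi.1, hiR]) u hu

/-- A separately bounded symmetric multilinear form whose polynomial is additive on pairs with zero
product vanishes when two of its arguments have zero product. -/
theorem apply_eq_zero_of_mul_eq_zero [CompactSpace X]
    (G : MultilinearMap ℝ≥0 (fun _ : ι => C(X, ℝ≥0)) ℝ)
    (hb : ∀ x i, ∃ C, ∀ f ≤ 1, |G (Function.update x i f)| ≤ C)
    (hsym : ∀ (σ : Equiv.Perm ι) x, G (fun i => x (σ i)) = G x)
    (hadd : ∀ f g : C(X, ℝ≥0), f * g = 0 → G (fun _ => f + g) = G (fun _ => f) + G (fun _ => g))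
    (x : ι → C(X, ℝ≥0)) {i j : ι} (hij : i ≠ j) (hx : x i * x j = 0) : G x = 0 := by
  obtain ⟨C, hC⟩ := hb x i
  have hle : ∀ ε : ℝ≥0, 0 < ε → |G x| ≤ C * ε := by
    intro ε hε
    -- The subtraction is truncated. The part `p` lives where `x i > ε`, while `x i = 0` wherever `x
    -- j ≠ 0`, so `x i` itself serves as the separating function with gap from `0` to `ε`. The part
    -- `q ≤ ε` contributes at most `C * ε`.
    let p : C(X, ℝ≥0) := ⟨fun u => x i u - ε, by fun_prop⟩
    let q : C(X, ℝ≥0) := ⟨fun u => min (x i u) ε, by fun_prop⟩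
    have hpq : x i = p + q := by ext u; simp [p, q, tsub_add_min]
    have hp : G (Function.update x i p) = 0 := by
      refine apply_eq_zero_of_separated G
        (fun x A a b ha hb hx => apply_eq_zero_of_orthogonal_groups G hsym hadd x A ha hb hx)
        (nnToReal (x i)) (a := j) (b := i) (Finset.univ \ {i, j}) 0 ε _ {j} (by exact_mod_cast hε)
        (by simp) (by simp) (by simpa using hij) (by simp) ?_ ?_
      · intro k hk _ u hu
        rw [Finset.mem_singleton.1 hk, Function.update_of_ne hij.symm] at hu
        have : x i u * x j u = 0 := congrArg (fun k : C(X, ℝ≥0) => k u) hx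
        simp [(mul_eq_zero.1 this).resolve_right hu]
      · intro k hk hk' u hu
        have hki : k = i := by
          simp only [Finset.mem_sdiff, Finset.mem_univ, true_and, not_not, Finset.mem_insert,
            Finset.mem_singleton] at hk hk'
          exact hk'.resolve_right hk
        subst hki
        rw [Function.update_self] at hu
        have : ε < x k u := by
          by_contra hc
          exact hu (tsub_eq_zero_of_le (not_lt.1 hc))
        exact_mod_cast this.le
    have hq : |G (Function.update x i q)| ≤ C * ε :=
      abs_apply_le_mul_of_le_smul_one (φ := G.toLinearMap x i) hC (fun u => by
        change min (x i u) ε ≤ ε • (1 : ℝ≥0)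
        simp)
    have e : G x = G (Function.update x i p) + G (Function.update x i q) := by
      rw [← G.map_update_add, ← hpq, Function.update_eq_self]
    rwa [e, hp, zero_add]
  have hC0 : 0 ≤ C := (abs_nonneg _).trans (hC 0 (fun u => zero_le))
  by_contra hne
  have hpos := abs_pos.2 hne
  have hd : 0 < |G x| / (2 * (C + 1)) := by positivity
  have := hle (Real.toNNReal _) (Real.toNNReal_pos.2 hd)
  rw [Real.coe_toNNReal _ hd.le, mul_div_assoc', le_div_iff₀ (by positivity)] at this
  nlinarith

end Multilinear

/-! ### Jordan decomposition and Riesz representation of bounded functionals -/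

section Riesz

variable {X : Type*} [TopologicalSpace X] [CompactSpace X]

/-- A bounded functional on the nonnegative continuous functions is a difference of nonnegative
ones. -/
theorem exists_nonneg_sub_nonneg (φ : C(X, ℝ≥0) →ₗ[ℝ≥0] ℝ) {C : ℝ} (hC : ∀ f ≤ 1, |φ f| ≤ C) :
    ∃ p q : C(X, ℝ≥0) →ₗ[ℝ≥0] ℝ≥0, ∀ f, φ f = p f - q f := by
  -- The positive part of `φ` at `f` is the supremum of `φ g` over `0 ≤ g ≤ f`; the negative part is
  -- this supremum minus `φ f`.
  have hlub : ∀ f : C(X, ℝ≥0), ∃ s, IsLUB (φ '' Set.Iic f) s := by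
    intro f
    refine Real.exists_isLUB ⟨φ f, f, Set.mem_Iic.2 le_rfl, rfl⟩ ⟨C * ‖nnToReal f‖₊, ?_⟩
    rintro _ ⟨g, hg, rfl⟩
    refine (le_abs_self _).trans (abs_apply_le_mul_of_le_smul_one hC fun u => (hg u).trans ?_)
    change f u ≤ ‖nnToReal f‖₊ • (1 : ℝ≥0)
    rw [smul_eq_mul, mul_one]
    have := (nnToReal f).norm_coe_le_norm u
    rw [nnToReal_apply, NNReal.norm_eq] at this
    exact_mod_cast this
  choose s hs using hlub
  have hle : ∀ {f g}, g ≤ f → φ g ≤ s f := fun h => (hs _).1 ⟨_, h, rfl⟩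
  have h0 : ∀ f, 0 ≤ s f := fun f => by
    simpa using hle (f := f) (g := 0) (fun u => zero_le)
  have hsadd : ∀ f g, s (f + g) = s f + s g := by
    intro f g
    refine le_antisymm ((hs _).2 ?_) ?_
    · rintro _ ⟨k, hk, rfl⟩
      -- Riesz decomposition: a function `k ≤ f + g` is the sum of `min k f ≤ f` and the truncated
      -- difference `k - f ≤ g`.
      let a : C(X, ℝ≥0) := ⟨fun u => min (k u) (f u), by fun_prop⟩
      let b : C(X, ℝ≥0) := ⟨fun u => k u - f u, by fun_prop⟩
      have hab : k = b + a := by ext u; simp [a, b, tsub_add_min]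
      rw [hab, map_add, add_comm]
      exact add_le_add (hle fun u => min_le_right _ _)
        (hle fun u => tsub_le_iff_left.2 (hk u))
    · rw [← le_sub_iff_add_le]
      refine (hs f).2 ?_
      rintro _ ⟨a, ha, rfl⟩
      rw [le_sub_iff_add_le, ← le_sub_iff_add_le']
      refine (hs g).2 ?_
      rintro _ ⟨b, hb, rfl⟩
      rw [le_sub_iff_add_le', ← map_add]
      exact hle fun u => add_le_add (ha u) (hb u)
  have hsmul_le : ∀ (c : ℝ≥0) f, c * s f ≤ s (c • f) := by
    intro c f
    rcases eq_or_ne c 0 with rfl | hc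
    · simpa using h0 _
    · have hc' : (0 : ℝ) < c := NNReal.coe_pos.2 (pos_iff_ne_zero.2 hc)
      rw [← le_div_iff₀' hc']
      refine (hs f).2 ?_
      rintro _ ⟨a, ha, rfl⟩
      rw [le_div_iff₀' hc']
      have := hle (f := c • f) (g := c • a) (fun u => mul_le_mul_right (ha u) c)
      simpa [NNReal.smul_def] using this
  have hssmul : ∀ (c : ℝ≥0) f, s (c • f) = c * s f := by
    intro c f
    refine le_antisymm ?_ (hsmul_le c f)
    rcases eq_or_ne c 0 with rfl | hc
    · have := hsadd 0 0
      rw [add_zero] at this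
      simp only [zero_smul, NNReal.coe_zero, zero_mul]
      linarith
    · have := hsmul_le c⁻¹ (c • f)
      rwa [smul_smul, inv_mul_cancel₀ hc, one_smul, NNReal.coe_inv,
        inv_mul_le_iff₀ (NNReal.coe_pos.2 (pos_iff_ne_zero.2 hc))] at this
  refine ⟨{ toFun := fun f => (s f).toNNReal
            map_add' := fun f g => by rw [hsadd, Real.toNNReal_add (h0 f) (h0 g)]
            map_smul' := fun c f => by
              rw [hssmul, Real.toNNReal_mul c.coe_nonneg, Real.toNNReal_coe]; rfl },
    { toFun := fun f => (s f - φ f).toNNReal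
      map_add' := fun f g => by
        rw [hsadd, map_add, add_sub_add_comm,
          Real.toNNReal_add (sub_nonneg.2 (hle le_rfl)) (sub_nonneg.2 (hle le_rfl))]
      map_smul' := fun c f => by
        rw [hssmul, map_smul, NNReal.smul_def, smul_eq_mul, ← mul_sub,
          Real.toNNReal_mul c.coe_nonneg,
          Real.toNNReal_coe]; rfl }, fun f => ?_⟩
  change φ f = ((s f).toNNReal : ℝ) - ((s f - φ f).toNNReal : ℝ)
  rw [Real.coe_toNNReal _ (h0 f), Real.coe_toNNReal _ (sub_nonneg.2 (hle le_rfl))]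
  ring

variable [T2Space X] [MeasurableSpace X] [BorelSpace X]

theorem exists_measure_integral_eq (p : C(X, ℝ≥0) →ₗ[ℝ≥0] ℝ≥0) :
    ∃ μ : Measure X, IsFiniteMeasure μ ∧ ∀ f : C(X, ℝ≥0), (p f : ℝ) = ∫ u, (f u : ℝ) ∂μ := by
  let Λ : CompactlySupportedContinuousMap X ℝ≥0 →ₗ[ℝ≥0] ℝ≥0 :=
    { toFun := fun f => p f.toContinuousMap
      map_add' := fun f g => p.map_add _ _
      map_smul' := fun c f => p.map_smul c _ }
  refine ⟨NNRealRMK.rieszMeasure Λ, inferInstance, fun f => ?_⟩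
  have := NNRealRMK.integral_rieszMeasure Λ
    (CompactlySupportedContinuousMap.continuousMapEquiv f)
  exact this.symm

/-- The Riesz representation of a bounded functional as a difference of two finite measures. -/
theorem exists_measures_integral_sub_integral (φ : C(X, ℝ≥0) →ₗ[ℝ≥0] ℝ) {C : ℝ}
    (hC : ∀ f ≤ 1, |φ f| ≤ C) :
    ∃ μ ν : Measure X, IsFiniteMeasure μ ∧ IsFiniteMeasure ν ∧
      ∀ f : C(X, ℝ≥0), φ f = ∫ u, (f u : ℝ) ∂μ - ∫ u, (f u : ℝ) ∂ν := by
  obtain ⟨p, q, hpq⟩ := exists_nonneg_sub_nonneg φ hC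
  obtain ⟨μ, hμ, hμp⟩ := exists_measure_integral_eq p
  obtain ⟨ν, hν, hνq⟩ := exists_measure_integral_eq q
  exact ⟨μ, ν, hμ, hν, fun f => by rw [hpq, hμp, hνq]⟩

end Riesz

/-! ### Integrals against signed measures -/

section Signed

variable {X : Type*} [MeasurableSpace X]

theorem isFiniteMeasure_totalVariation (μ : SignedMeasure X) :
    IsFiniteMeasure μ.totalVariation := by
  unfold SignedMeasure.totalVariation
  infer_instance

variable [TopologicalSpace X] [CompactSpace X] [BorelSpace X]

theorem vectorMeasure_integrable_of_continuous (μ : SignedMeasure X) {f : X → ℝ}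
    (hf : Continuous f) : μ.Integrable f := by
  have := isFiniteMeasure_totalVariation μ
  rw [SignedMeasure.totalVariation_eq_variation] at this
  exact hf.integrable_of_hasCompactSupport (HasCompactSupport.of_compactSpace f)

theorem integral_toSignedMeasure_sub (μ ν : Measure X) [IsFiniteMeasure μ] [IsFiniteMeasure ν]
    {f : X → ℝ} (hf : Continuous f) :
    ∫ᵛ u, f u ∂<•(μ.toSignedMeasure - ν.toSignedMeasure) = ∫ u, f u ∂μ - ∫ u, f u ∂ν := by
  rw [VectorMeasure.integral_sub_vectorMeasure (vectorMeasure_integrable_of_continuous _ hf)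
    (vectorMeasure_integrable_of_continuous _ hf), VectorMeasure.integral_toSignedMeasure,
    VectorMeasure.integral_toSignedMeasure]

end Signed

/-! ### Uniqueness of uniformly distributed signed measures -/

section UniformlyDistributed

variable {X : Type*} [MetricSpace X] [CompactSpace X] [MeasurableSpace X] [BorelSpace X]

theorem integrable_of_continuous_of_compactSpace {f : X → ℝ} (hf : Continuous f) (μ : Measure X)
    [IsFiniteMeasure μ] : Integrable f μ :=
  hf.integrable_of_hasCompactSupport (HasCompactSupport.of_compactSpace f)

/-- If the tent functions `max 0 (ε - dist x ·)` have integrals independent of `x`, both for `σ` and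
for the signed measure `μ - ν`, then `μ - ν` is a multiple of `σ`. -/
theorem exists_integral_sub_integral_eq_mul [Nonempty X] (μ ν σ : Measure X) [IsFiniteMeasure μ]
    [IsFiniteMeasure ν] [IsFiniteMeasure σ]
    (hσ : ∀ ε : ℝ, 0 < ε → ∃ a, 0 < a ∧ ∀ x, ∫ y, max 0 (ε - dist x y) ∂σ = a)
    (hμ : ∀ ε : ℝ, 0 < ε → ∃ b, ∀ x,
      ∫ y, max 0 (ε - dist x y) ∂μ - ∫ y, max 0 (ε - dist x y) ∂ν = b) :
    ∃ c : ℝ, ∀ f : X → ℝ, Continuous f → ∫ x, f x ∂μ - ∫ x, f x ∂ν = c * ∫ x, f x ∂σ := by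
  have swap : ∀ (ε : ℝ) (f : X → ℝ), Continuous f → ∀ (τ : Measure X) [IsFiniteMeasure τ],
      ∫ x, f x * ∫ y, max 0 (ε - dist x y) ∂τ ∂σ =
        ∫ y, ∫ x, f x * max 0 (ε - dist y x) ∂σ ∂τ := by
    intro ε f hf τ _
    simp_rw [← integral_const_mul]
    rw [integral_integral_swap_of_hasCompactSupport
      (f := fun x y => f x * max 0 (ε - dist x y)) (by fun_prop)
      (HasCompactSupport.of_compactSpace _)]
    simp_rw [dist_comm]
  have hcont : ∀ (ε : ℝ) (τ : Measure X) [IsFiniteMeasure τ] (f : X → ℝ), Continuous f →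
      Continuous fun y => ∫ x, f x * max 0 (ε - dist y x) ∂τ := by
    intro ε τ _ f hf
    have := continuous_parametric_integral_of_continuous (μ := τ)
      (f := fun y x => f x * max 0 (ε - dist y x)) (by fun_prop) isCompact_univ
    simpa using this
  -- Integrate the constant `b` against `f` and exchange the order of integration: `b ∫ f dσ` equals
  -- the integral over `μ - ν` of the tent averages of `f`.
  have key : ∀ (ε b : ℝ) (f : X → ℝ), Continuous f →
      (∀ x, ∫ y, max 0 (ε - dist x y) ∂μ - ∫ y, max 0 (ε - dist x y) ∂ν = b) →
      b * ∫ x, f x ∂σ = ∫ y, ∫ x, f x * max 0 (ε - dist y x) ∂σ ∂μ -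
        ∫ y, ∫ x, f x * max 0 (ε - dist y x) ∂σ ∂ν := by
    intro ε b f hf hb
    have hc : ∀ (τ : Measure X) [IsFiniteMeasure τ],
        Continuous fun x => f x * ∫ y, max 0 (ε - dist x y) ∂τ := by
      intro τ _
      have := hcont ε τ (fun _ => 1) continuous_const
      simp only [one_mul] at this
      exact hf.mul this
    rw [← swap ε f hf μ, ← swap ε f hf ν,
      ← integral_sub (integrable_of_continuous_of_compactSpace (hc μ) σ)
        (integrable_of_continuous_of_compactSpace (hc ν) σ), ← integral_const_mul]
    refine integral_congr_ae (Filter.Eventually.of_forall fun x => ?_)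
    simp only [← mul_sub, hb x, mul_comm]
  refine ⟨(μ.real Set.univ - ν.real Set.univ) / σ.real Set.univ, fun f hf => ?_⟩
  have est : ∀ δ > 0, |(μ.real Set.univ - ν.real Set.univ) / σ.real Set.univ * ∫ x, f x ∂σ -
      (∫ x, f x ∂μ - ∫ x, f x ∂ν)| ≤ δ * (μ.real Set.univ + ν.real Set.univ) := by
    intro δ hδ
    obtain ⟨ε, hε, hfε⟩ := Metric.uniformContinuous_iff.1
      (CompactSpace.uniformContinuous_of_continuous hf) δ hδ
    obtain ⟨a, ha, hσa⟩ := hσ ε hε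
    obtain ⟨b, hb⟩ := hμ ε hε
    have hone := key ε b (fun _ => 1) continuous_const hb
    simp only [one_mul, hσa, integral_const, smul_eq_mul, mul_one] at hone
    have hσ0 : σ.real Set.univ ≠ 0 := by
      intro h0
      rw [measureReal_eq_zero_iff, Measure.measure_univ_eq_zero] at h0
      have := hσa (Classical.arbitrary X)
      rw [h0, integral_zero_measure] at this
      exact ha.ne this
    -- The case `f = 1` shows that `b / a` is the ratio of total masses, hence the same for every
    -- `ε`.
    have hba : b = a * ((μ.real Set.univ - ν.real Set.univ) / σ.real Set.univ) := by
      field_simp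
      linarith
    -- The tent at `y` has `σ`-mass `a` and radius `ε`, so the tent average differs from `a * f y`
    -- by at most `a` times the oscillation `δ`. The factor `a` cancels at the end.
    have hloc : ∀ y, |∫ x, f x * max 0 (ε - dist y x) ∂σ - a * f y| ≤ δ * a := by
      intro y
      have hk : Continuous fun x => max 0 (ε - dist y x) := by fun_prop
      have e : ∫ x, f x * max 0 (ε - dist y x) ∂σ - a * f y =
          ∫ x, (f x - f y) * max 0 (ε - dist y x) ∂σ := by
        simp_rw [sub_mul]
        rw [integral_sub (integrable_of_continuous_of_compactSpace (by fun_prop) σ)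
          (integrable_of_continuous_of_compactSpace (by fun_prop) σ),
          integral_const_mul, hσa, mul_comm a]
      rw [e, ← hσa y, ← integral_const_mul, ← Real.norm_eq_abs]
      refine norm_integral_le_of_norm_le
        (integrable_of_continuous_of_compactSpace (continuous_const.mul hk) σ)
        (Filter.Eventually.of_forall fun x => ?_)
      rw [norm_mul, Real.norm_eq_abs, Real.norm_eq_abs,
        abs_of_nonneg (le_max_left 0 (ε - dist y x))]
      rcases le_or_gt ε (dist y x) with h | h
      · rw [max_eq_left (by linarith)]; simp
      · have := hfε (a := x) (b := y) (by rwa [dist_comm])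
        rw [Real.dist_eq] at this
        exact mul_le_mul_of_nonneg_right this.le (le_max_left _ _)
    have hτ : ∀ (τ : Measure X) [IsFiniteMeasure τ],
        |∫ y, ∫ x, f x * max 0 (ε - dist y x) ∂σ ∂τ - a * ∫ y, f y ∂τ| ≤
          δ * a * τ.real Set.univ := by
      intro τ _
      rw [← integral_const_mul, ← integral_sub
        (integrable_of_continuous_of_compactSpace (hcont ε σ f hf) τ)
        (integrable_of_continuous_of_compactSpace (by fun_prop) τ)]
      rw [← Real.norm_eq_abs]
      exact norm_integral_le_of_norm_le_const
        (Filter.Eventually.of_forall fun y => (Real.norm_eq_abs _).trans_le (hloc y))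
    have hk := key ε b f hf hb
    have h1 := hτ μ
    have h2 := hτ ν
    have e : a * ((μ.real Set.univ - ν.real Set.univ) / σ.real Set.univ * ∫ x, f x ∂σ -
        (∫ x, f x ∂μ - ∫ x, f x ∂ν)) =
        (∫ y, ∫ x, f x * max 0 (ε - dist y x) ∂σ ∂μ - a * ∫ y, f y ∂μ) -
        (∫ y, ∫ x, f x * max 0 (ε - dist y x) ∂σ ∂ν - a * ∫ y, f y ∂ν) := by
      rw [mul_sub, ← mul_assoc, ← hba, hk]; ring
    have h3 := (congrArg abs e).le.trans ((abs_sub _ _).trans (add_le_add h1 h2))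
    rw [abs_mul, abs_of_pos ha] at h3
    refine le_of_mul_le_mul_left (h3.trans (le_of_eq ?_)) ha
    ring
  have hM : 0 ≤ μ.real Set.univ + ν.real Set.univ := by positivity
  have hle : ∀ A M : ℝ, 0 ≤ M → (∀ δ > 0, A ≤ δ * M) → A ≤ 0 := by
    intro A M hM h
    by_contra! hA
    have := h _ (div_pos hA (by positivity : 0 < 2 * (M + 1)))
    rw [div_mul_eq_mul_div, le_div_iff₀ (by positivity)] at this
    nlinarith
  exact (sub_eq_zero.1 (abs_nonpos_iff.1 (hle _ _ hM est))).symm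

end UniformlyDistributed

/-! ### Rotations of the sphere and the spherical Lebesgue measure -/

section Sphere

open scoped Pointwise

variable {n : ℕ}

/-- Up to a constant factor, `toSphere` measures a set by the volume of the cone over it. Forming
cones commutes with `φ`, and `φ` preserves volume. -/
theorem integral_toSphere_comp_sphereMap (φ : Euc n ≃ₗᵢ[ℝ] Euc n) {f : UnitSphere n → ℝ} :
    ∫ u, f (StarBody.sphereMap φ u) ∂((volume : Measure (Euc n)).toSphere) =
      ∫ u, f u ∂((volume : Measure (Euc n)).toSphere) := by
  let e : UnitSphere n ≃ₜ UnitSphere n :=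
    { toFun := StarBody.sphereMap φ
      invFun := StarBody.sphereMap φ.symm
      left_inv := fun u => by ext1; simp [StarBody.sphereMap]
      right_inv := fun u => by ext1; simp [StarBody.sphereMap]
      continuous_toFun := StarBody.continuous_sphereMap φ
      continuous_invFun := StarBody.continuous_sphereMap φ.symm }
  have hp : MeasurePreserving e (volume : Measure (Euc n)).toSphere
      (volume : Measure (Euc n)).toSphere := by
    refine ⟨e.continuous.measurable, ?_⟩
    ext s hs
    rw [Measure.map_apply e.continuous.measurable hs,
      Measure.toSphere_apply' _ (e.continuous.measurable hs), Measure.toSphere_apply' _ hs]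
    congr 1
    have : (Set.Ioo (0 : ℝ) 1 • ((↑) '' (e ⁻¹' s) : Set (Euc n))) =
        φ ⁻¹' (Set.Ioo (0 : ℝ) 1 • ((↑) '' s : Set (Euc n))) := by
      ext x
      simp only [Set.mem_smul, Set.mem_image, Set.mem_preimage]
      constructor
      · rintro ⟨r, hr, _, ⟨u, hu, rfl⟩, rfl⟩
        exact ⟨r, hr, _, ⟨e u, hu, rfl⟩, by simp [e, StarBody.sphereMap]⟩
      · rintro ⟨r, hr, _, ⟨u, hu, rfl⟩, hx⟩
        refine ⟨r, hr, _, ⟨e.symm u, by simpa using hu, rfl⟩, ?_⟩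
        apply φ.injective
        rw [← hx, map_smul]
        congr 1
        exact congrArg Subtype.val (e.apply_symm_apply u)
    rw [this]
    exact φ.measurePreserving.measure_preimage_emb φ.toHomeomorph.measurableEmbedding _
  exact hp.integral_comp e.measurableEmbedding f

/-- In dimension at least two, the rotations act transitively on the unit sphere. -/
theorem exists_rotation_apply_eq (hn : 2 ≤ n) (u v : UnitSphere n) :
    ∃ φ : Euc n ≃ₗᵢ[ℝ] Euc n, LinearMap.det (φ.toLinearEquiv : Euc n →ₗ[ℝ] Euc n) = 1 ∧
      StarBody.sphereMap φ u = v := by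
  have hnorm : ∀ w : UnitSphere n, ‖(w : Euc n)‖ = 1 := fun w => by simp
  have hdet : ∀ w : Euc n, w ≠ 0 → LinearMap.det
      ((Submodule.reflection (ℝ ∙ w)ᗮ).toLinearEquiv : Euc n →ₗ[ℝ] Euc n) = -1 := by
    intro w hw
    have := Submodule.det_reflection (𝕜 := ℝ) (ℝ ∙ w)ᗮ
    rw [Submodule.orthogonal_orthogonal, finrank_span_singleton hw, pow_one] at this
    exact this
  by_cases huv : u = v
  · subst huv
    exact ⟨LinearIsometryEquiv.refl ℝ _, LinearMap.det_id, rfl⟩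
  · have huv' : (u : Euc n) - v ≠ 0 := sub_ne_zero.2 fun h => huv (Subtype.ext h)
    -- The reflection in the hyperplane orthogonal to `u - v` takes `u` to `v` but has determinant
    -- `-1`. A second reflection, in a hyperplane containing `v`, corrects the sign; its normal `w`
    -- exists because `n ≥ 2`.
    obtain ⟨w, hw0, hw⟩ : ∃ w : Euc n, w ≠ 0 ∧ inner ℝ w (v : Euc n) = 0 := by
      have hne : (ℝ ∙ (v : Euc n))ᗮ ≠ ⊥ := by
        intro h
        have h1 := Submodule.finrank_add_finrank_orthogonal (ℝ ∙ (v : Euc n))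
        rw [h, finrank_bot, finrank_euclideanSpace_fin,
          finrank_span_singleton (by intro h0; have := hnorm v; simp [h0] at this)] at h1
        omega
      obtain ⟨w, hw, hw0⟩ := Submodule.exists_mem_ne_zero_of_ne_bot hne
      exact ⟨w, hw0, Submodule.mem_orthogonal_singleton_iff_inner_left.1 hw⟩
    refine ⟨(Submodule.reflection (ℝ ∙ ((u : Euc n) - v))ᗮ).trans
      (Submodule.reflection (ℝ ∙ w)ᗮ), ?_, ?_⟩
    · have : (((Submodule.reflection (ℝ ∙ ((u : Euc n) - v))ᗮ).trans
          (Submodule.reflection (ℝ ∙ w)ᗮ)).toLinearEquiv : Euc n →ₗ[ℝ] Euc n) =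
          ((Submodule.reflection (ℝ ∙ w)ᗮ).toLinearEquiv : Euc n →ₗ[ℝ] Euc n) ∘ₗ
          ((Submodule.reflection (ℝ ∙ ((u : Euc n) - v))ᗮ).toLinearEquiv : Euc n →ₗ[ℝ] Euc n) := rfl
      rw [this, LinearMap.det_comp, hdet _ hw0, hdet _ huv']
      norm_num
    · apply Subtype.ext
      change Submodule.reflection (ℝ ∙ w)ᗮ (Submodule.reflection (ℝ ∙ ((u : Euc n) - v))ᗮ u) = v
      rw [Submodule.reflection_sub (by rw [hnorm, hnorm])]
      apply Submodule.reflection_mem_subspace_eq_self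
      rw [Submodule.mem_orthogonal_singleton_iff_inner_left, real_inner_comm]
      exact hw

theorem dist_sphereMap (φ : Euc n ≃ₗᵢ[ℝ] Euc n) (u v : UnitSphere n) :
    dist (StarBody.sphereMap φ u) (StarBody.sphereMap φ v) = dist u v :=
  φ.dist_map u v

/-- A rotation invariant difference of two finite measures on the sphere is a multiple of the
spherical Lebesgue measure. -/
theorem exists_integral_sub_integral_eq_mul_toSphere (hn : 2 ≤ n) (μ ν : Measure (UnitSphere n))
    [IsFiniteMeasure μ] [IsFiniteMeasure ν]
    (hinv : ∀ φ : Euc n ≃ₗᵢ[ℝ] Euc n,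
      LinearMap.det (φ.toLinearEquiv : Euc n →ₗ[ℝ] Euc n) = 1 → ∀ f : UnitSphere n → ℝ,
      Continuous f → (∀ u, 0 ≤ f u) →
      ∫ u, f (StarBody.sphereMap φ.symm u) ∂μ - ∫ u, f (StarBody.sphereMap φ.symm u) ∂ν =
        ∫ u, f u ∂μ - ∫ u, f u ∂ν) :
    ∃ c : ℝ, ∀ f : UnitSphere n → ℝ, Continuous f → ∫ u, f u ∂μ - ∫ u, f u ∂ν =
      c * ∫ u, f u ∂((volume : Measure (Euc n)).toSphere) := by
  have : Nontrivial (Euc n) :=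
    Module.nontrivial_of_finrank_pos (R := ℝ) (by rw [finrank_euclideanSpace_fin]; omega)
  obtain ⟨x₀⟩ : Nonempty (UnitSphere n) := (NormedSpace.sphere_nonempty.2 zero_le_one).to_subtype
  -- Rotating the centre of a tent amounts to rotating its variable back. By transitivity,
  -- invariance makes the tent integrals independent of the centre.
  have htent : ∀ (ε : ℝ) (φ : Euc n ≃ₗᵢ[ℝ] Euc n) (x y : UnitSphere n),
      max 0 (ε - dist (StarBody.sphereMap φ x) y) =
        max 0 (ε - dist x (StarBody.sphereMap φ.symm y)) := by
    intro ε φ x y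
    rw [← dist_sphereMap φ x]
    congr 3
    ext1
    simp [StarBody.sphereMap]
  have : Nonempty (UnitSphere n) := ⟨x₀⟩
  refine exists_integral_sub_integral_eq_mul μ ν _ (fun ε hε => ?_) (fun ε hε => ?_)
  · refine ⟨∫ y, max 0 (ε - dist x₀ y) ∂((volume : Measure (Euc n)).toSphere), ?_, fun x => ?_⟩
    · refine Continuous.integral_pos_of_hasCompactSupport_nonneg_nonzero (x := x₀) (by fun_prop)
        (HasCompactSupport.of_compactSpace _) (fun y => le_max_left _ _) ?_
      simp [hε]
    · obtain ⟨φ, -, rfl⟩ := exists_rotation_apply_eq hn x₀ x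
      simp_rw [htent]
      exact integral_toSphere_comp_sphereMap φ.symm (f := fun y => max 0 (ε - dist x₀ y))
  · refine ⟨∫ y, max 0 (ε - dist x₀ y) ∂μ - ∫ y, max 0 (ε - dist x₀ y) ∂ν, fun x => ?_⟩
    obtain ⟨φ, hφ, rfl⟩ := exists_rotation_apply_eq hn x₀ x
    simp_rw [htent]
    exact hinv φ hφ (fun y => max 0 (ε - dist x₀ y)) (by fun_prop) (fun y => le_max_left _ _)

end Sphere

/-! ### Translation between star bodies and radial functions -/

section Bridge

variable {n m : ℕ}

namespace StarBody

/-- The radial function as a nonnegative continuous function on the sphere. -/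
noncomputable def radialMap (L : StarBody n) : C(UnitSphere n, ℝ≥0) :=
  ⟨fun u => (L.radial u).toNNReal, continuous_real_toNNReal.comp L.continuous_radial⟩

@[simp] theorem coe_radialMap (L : StarBody n) (u : UnitSphere n) :
    (L.radialMap u : ℝ) = L.radial u :=
  Real.coe_toNNReal _ (L.radial_nonneg u)

/-- The star body with a given radial function. -/
def ofRadialMap (f : C(UnitSphere n, ℝ≥0)) : StarBody n :=
  ofRadial (fun u => (f u : ℝ)) (fun u => (f u).coe_nonneg) (by fun_prop)

@[simp] theorem radial_ofRadialMap (f : C(UnitSphere n, ℝ≥0)) (u : UnitSphere n) :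
    (ofRadialMap f).radial u = f u := by
  rw [ofRadialMap, radial_ofRadial]

@[simp] theorem ofRadialMap_radialMap (L : StarBody n) : ofRadialMap L.radialMap = L := by
  apply radial_injective
  ext u; simp

@[simp] theorem radial_radialSum (L M : StarBody n) (u : UnitSphere n) :
    (L.radialSum M).radial u = L.radial u + M.radial u :=
  congrFun (radial_ofRadial _ _ _) u

theorem ofRadialMap_add (f g : C(UnitSphere n, ℝ≥0)) :
    ofRadialMap (f + g) = (ofRadialMap f).radialSum (ofRadialMap g) := by
  apply radial_injective
  ext u; simp

theorem ofRadialMap_smul (c : ℝ≥0) (hc : (0 : ℝ) < c) (f : C(UnitSphere n, ℝ≥0)) :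
    ofRadialMap (c • f) = (ofRadialMap f).dilate c hc := by
  apply radial_injective
  ext u
  rw [radial_ofRadialMap]
  change _ = radialFunction ((fun x => (c : ℝ) • x) '' (ofRadialMap f).carrier) u
  rw [radialFunction_dilate _ hc]
  change _ = (c : ℝ) * (ofRadialMap f).radial u
  rw [radial_ofRadialMap]
  simp

theorem ofRadialMap_zero_radialSum :
    (ofRadialMap (0 : C(UnitSphere n, ℝ≥0))).radialSum (ofRadialMap 0) = ofRadialMap 0 := by
  rw [← ofRadialMap_add, add_zero]

theorem smul_mem_carrier_iff (L : StarBody n) (u : UnitSphere n) {c : ℝ} (hc : 0 ≤ c) :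
    c • (u : Euc n) ∈ L.carrier ↔ c ≤ L.radial u := by
  refine ⟨fun h => (L.isStarSet.isGreatest u).2 h, fun h => ?_⟩
  obtain ⟨a, b, hab⟩ := L.isStarSet.2 u
  have h0 : (0 : ℝ) ∈ {c : ℝ | c • (u : Euc n) ∈ L.carrier} := by simpa using L.isStarSet.1
  have h1 := (L.isStarSet.isGreatest u).1
  have h2 : c ∈ {c : ℝ | c • (u : Euc n) ∈ L.carrier} := by
    rw [hab] at h0 h1 ⊢
    exact ⟨h0.1.trans hc, h.trans h1.2⟩
  exact h2

theorem exists_eq_norm_smul {x : Euc n} (hx : x ≠ 0) :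
    ∃ u : UnitSphere n, x = ‖x‖ • (u : Euc n) := by
  have hn : ‖x‖ ≠ 0 := norm_ne_zero_iff.2 hx
  exact ⟨⟨‖x‖⁻¹ • x, by simp [norm_smul, hn]⟩, by simp [smul_smul, hn]⟩

theorem inter_carrier_eq_zero_iff (L M : StarBody n) :
    L.carrier ∩ M.carrier = {0} ↔ ∀ u, L.radial u * M.radial u = 0 := by
  constructor
  · intro h u
    have h0 : 0 ≤ min (L.radial u) (M.radial u) := le_min (L.radial_nonneg u) (M.radial_nonneg u)
    have h1 : min (L.radial u) (M.radial u) • (u : Euc n) ∈ L.carrier ∩ M.carrier :=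
      ⟨(L.smul_mem_carrier_iff u h0).2 (min_le_left _ _),
        (M.smul_mem_carrier_iff u h0).2 (min_le_right _ _)⟩
    have hu : (u : Euc n) ≠ 0 := ne_zero_of_mem_unit_sphere u
    rw [h, Set.mem_singleton_iff, smul_eq_zero, or_iff_left hu] at h1
    rcases min_choice (L.radial u) (M.radial u) with h2 | h2 <;> rw [h2] at h1 <;> simp [h1]
  · intro h
    refine Set.Subset.antisymm (fun x hx => ?_)
      (Set.singleton_subset_iff.2 ⟨L.isStarSet.1, M.isStarSet.1⟩)
    by_contra hx0
    obtain ⟨u, hu⟩ := exists_eq_norm_smul hx0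
    have hpos : 0 < ‖x‖ := norm_pos_iff.2 hx0
    rw [hu] at hx
    have h1 := (L.smul_mem_carrier_iff u hpos.le).1 hx.1
    have h2 := (M.smul_mem_carrier_iff u hpos.le).1 hx.2
    exact (mul_pos (hpos.trans_le h1) (hpos.trans_le h2)).ne' (h u)

theorem inter_carrier_ofRadialMap {f g : C(UnitSphere n, ℝ≥0)} (h : f * g = 0) :
    (ofRadialMap f).carrier ∩ (ofRadialMap g).carrier = {0} := by
  rw [inter_carrier_eq_zero_iff]
  intro u
  have : f u * g u = 0 := congrArg (fun k : C(UnitSphere n, ℝ≥0) => k u) h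
  rw [radial_ofRadialMap, radial_ofRadialMap, ← NNReal.coe_mul, this, NNReal.coe_zero]

theorem carrier_ofRadialMap_subset {f : C(UnitSphere n, ℝ≥0)} (hf : f ≤ 1) :
    (ofRadialMap f).carrier ⊆ Metric.closedBall (0 : Euc n) 1 := by
  intro x hx
  rw [mem_closedBall_zero_iff]
  by_cases hx0 : x = 0
  · simp [hx0]
  · obtain ⟨u, hu⟩ := exists_eq_norm_smul hx0
    rw [hu] at hx
    have h1 := ((ofRadialMap f).smul_mem_carrier_iff u (norm_nonneg x)).1 hx
    rw [radial_ofRadialMap] at h1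
    have h2 : f u ≤ 1 := hf u
    exact h1.trans (by exact_mod_cast h2)

theorem radial_map (φ : Euc n ≃ₗᵢ[ℝ] Euc n) (L : StarBody n) (u : UnitSphere n) :
    (L.map φ).radial u = L.radial (sphereMap φ.symm u) :=
  congrFun (radialFunction_map φ L) u

end StarBody

open StarBody

/-- A separately additive and positively homogeneous functional, as a multilinear form on radial
functions. -/
noncomputable def radialForm (F : (Fin m → StarBody n) → ℝ) (hadd : SeparatelyAdditive F)
    (hhom : PositivelyHomogeneous F) :
    MultilinearMap ℝ≥0 (fun _ : Fin m => C(UnitSphere n, ℝ≥0)) ℝ :=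
  have hup : ∀ (x : Fin m → C(UnitSphere n, ℝ≥0)) i f,
      (fun k => ofRadialMap (Function.update x i f k)) =
        Function.update (fun k => ofRadialMap (x k)) i (ofRadialMap f) := fun x i f => by
    ext1 k
    exact Function.apply_update (fun _ => ofRadialMap) x i f k
  { toFun := fun x => F fun k => ofRadialMap (x k)
    map_update_add' := fun {inst} x i f g => by
      have : inst = instDecidableEqFin m := Subsingleton.elim _ _
      subst this
      rw [hup, hup, hup, ofRadialMap_add, hadd]
    map_update_smul' := fun {inst} x i c f => by
      have : inst = instDecidableEqFin m := Subsingleton.elim _ _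
      subst this
      rw [hup, hup]
      rcases eq_or_ne c 0 with rfl | hc
      -- Homogeneity is assumed for `c > 0` only. At `c = 0`, the body `{0}` is its own radial
      -- double, so additivity makes `F` vanish on it.
      · have := hadd (fun k => ofRadialMap (x k)) i (ofRadialMap 0) (ofRadialMap 0)
        rw [ofRadialMap_zero_radialSum] at this
        rw [zero_smul, zero_smul]
        linarith
      · rw [ofRadialMap_smul c (NNReal.coe_pos.2 (pos_iff_ne_zero.2 hc)), hhom]
        rfl }

theorem radialForm_apply (F : (Fin m → StarBody n) → ℝ) (hadd : SeparatelyAdditive F)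
    (hhom : PositivelyHomogeneous F) (x : Fin m → C(UnitSphere n, ℝ≥0)) :
    radialForm F hadd hhom x = F fun k => ofRadialMap (x k) := rfl

theorem eq_radialForm (F : (Fin m → StarBody n) → ℝ) (hadd : SeparatelyAdditive F)
    (hhom : PositivelyHomogeneous F) (L : Fin m → StarBody n) :
    F L = radialForm F hadd hhom fun k => (L k).radialMap := by
  simp [radialForm_apply]

/-- A nonnegative additive form is monotone: `1 = f + (1 - f)`, and the second summand contributes a
nonnegative amount. -/
theorem radialForm_bounded_of_nonneg (F : (Fin m → StarBody n) → ℝ) (hadd : SeparatelyAdditive F)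
    (hhom : PositivelyHomogeneous F) (h0 : ∀ L, 0 ≤ F L) (x : Fin m → C(UnitSphere n, ℝ≥0))
    (i : Fin m) {f : C(UnitSphere n, ℝ≥0)} (hf : f ≤ 1) :
    |radialForm F hadd hhom (Function.update x i f)| ≤
      radialForm F hadd hhom (Function.update x i 1) := by
  let g : C(UnitSphere n, ℝ≥0) := ⟨fun u => 1 - f u, by fun_prop⟩
  have hfg : (1 : C(UnitSphere n, ℝ≥0)) = f + g := by
    ext1 u
    exact (add_tsub_cancel_of_le (hf u)).symm
  have hG : ∀ y, 0 ≤ radialForm F hadd hhom y := fun y => h0 _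
  rw [hfg, MultilinearMap.map_update_add, abs_of_nonneg (hG _)]
  exact le_add_of_nonneg_right (hG _)

theorem radialForm_separately_bounded (F : (Fin m → StarBody n) → ℝ) (hadd : SeparatelyAdditive F)
    (hhom : PositivelyHomogeneous F) (hAB : IsDifferenceOfNonneg F ∨ SeparatelyBounded F)
    (x : Fin m → C(UnitSphere n, ℝ≥0)) (i : Fin m) :
    ∃ C, ∀ f ≤ 1, |radialForm F hadd hhom (Function.update x i f)| ≤ C := by
  rcases hAB with ⟨Fp, Fm, ⟨pa, ph, p0⟩, ⟨qa, qh, q0⟩, hF⟩ | hB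
  · refine ⟨radialForm Fp pa ph (Function.update x i 1) +
      radialForm Fm qa qh (Function.update x i 1),
      fun f hf => ?_⟩
    have h1 := radialForm_bounded_of_nonneg Fp pa ph p0 x i hf
    have h2 := radialForm_bounded_of_nonneg Fm qa qh q0 x i hf
    rw [radialForm_apply F, hF]
    exact (abs_sub _ _).trans (add_le_add h1 h2)
  · obtain ⟨C, hC⟩ := hB i fun k => ofRadialMap (x k)
    refine ⟨C, fun f hf => ?_⟩
    have e : (fun k => ofRadialMap (Function.update x i f k)) =
        Function.update (fun k => ofRadialMap (x k)) i (ofRadialMap f) := by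
      ext1 k
      exact Function.apply_update (fun _ => ofRadialMap) x i f k
    rw [radialForm_apply, e]
    exact hC _ (carrier_ofRadialMap_subset hf)

theorem continuous_prod_radial (L : Fin m → StarBody n) :
    Continuous fun u => ∏ i, (L i).radial u :=
  continuous_finsetProd _ fun i _ => (L i).continuous_radial

theorem VanishesOnDisjoint.of_hasMeasureRepresentation {F : (Fin m → StarBody n) → ℝ}
    (h : HasMeasureRepresentation F) : VanishesOnDisjoint F := by
  obtain ⟨μ, -, hμ⟩ := h
  rintro L ⟨i, j, hij, hL⟩
  have : (fun u => ∏ k, (L k).radial u) = fun _ => 0 := by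
    ext u
    rcases mul_eq_zero.1 ((inter_carrier_eq_zero_iff _ _).1 hL u) with h | h
    exacts [Finset.prod_eq_zero (Finset.mem_univ i) h, Finset.prod_eq_zero (Finset.mem_univ j) h]
  rw [hμ, this, VectorMeasure.integral_zero]

theorem IsSymmetricFunctional.of_hasMeasureRepresentation {F : (Fin m → StarBody n) → ℝ}
    (h : HasMeasureRepresentation F) : IsSymmetricFunctional F := by
  obtain ⟨μ, -, hμ⟩ := h
  intro σ L
  rw [hμ, hμ]
  congr 1
  ext u
  exact Equiv.prod_comp σ fun i => (L i).radial u

theorem IsOrthogonallyAdditive.of_hasMeasureRepresentation (hm : 1 ≤ m)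
    {F : (Fin m → StarBody n) → ℝ} (h : HasMeasureRepresentation F) :
    IsOrthogonallyAdditive (associatedPolynomial F) := by
  obtain ⟨μ, -, hμ⟩ := h
  intro L M hLM
  rw [inter_carrier_eq_zero_iff] at hLM
  -- At each `u` one of the two radial values is `0`, and `0 ^ m = 0` requires `m ≠ 0`.
  have hm0 : m ≠ 0 := by omega
  have e : (fun u => ∏ _i : Fin m, (L.radialSum M).radial u) =
      fun u => ∏ _i : Fin m, L.radial u + ∏ _i : Fin m, M.radial u := by
    ext u
    simp only [Finset.prod_const, Finset.card_univ, Fintype.card_fin, radial_radialSum]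
    rcases mul_eq_zero.1 (hLM u) with h | h <;> simp [h, hm0]
  rw [associatedPolynomial, associatedPolynomial, associatedPolynomial, hμ, hμ, hμ, e]
  exact VectorMeasure.integral_fun_add
    (vectorMeasure_integrable_of_continuous μ (continuous_prod_radial fun _ => L))
    (vectorMeasure_integrable_of_continuous μ (continuous_prod_radial fun _ => M))

theorem radialForm_eq_zero {F : (Fin m → StarBody n) → ℝ} (hadd : SeparatelyAdditive F)
    (hhom : PositivelyHomogeneous F) (hF : VanishesOnDisjoint F)
    (x : Fin m → C(UnitSphere n, ℝ≥0)) (hx : ∃ i j, i ≠ j ∧ x i * x j = 0) :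
    radialForm F hadd hhom x = 0 := by
  obtain ⟨i, j, hij, hx⟩ := hx
  exact hF _ ⟨i, j, hij, inter_carrier_ofRadialMap hx⟩

theorem VanishesOnDisjoint.of_isSymmetricFunctional {F : (Fin m → StarBody n) → ℝ}
    (hadd : SeparatelyAdditive F) (hhom : PositivelyHomogeneous F)
    (hAB : IsDifferenceOfNonneg F ∨ SeparatelyBounded F) (hsym : IsSymmetricFunctional F)
    (horth : IsOrthogonallyAdditive (associatedPolynomial F)) : VanishesOnDisjoint F := by
  rintro L ⟨i, j, hij, hL⟩
  rw [eq_radialForm F hadd hhom]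
  refine apply_eq_zero_of_mul_eq_zero (radialForm F hadd hhom)
    (radialForm_separately_bounded F hadd hhom hAB) (fun σ x => hsym σ fun k => ofRadialMap (x k))
    (fun f g hfg => ?_) _ hij ?_
  · have := horth _ _ (inter_carrier_ofRadialMap hfg)
    rwa [← ofRadialMap_add] at this
  · ext u
    simpa using (inter_carrier_eq_zero_iff _ _).1 hL u

/-- The representation of a functional vanishing on disjoint star bodies by a difference of two
finite measures. -/
theorem VanishesOnDisjoint.exists_measures (hm : 1 ≤ m) {F : (Fin m → StarBody n) → ℝ}
    (hadd : SeparatelyAdditive F) (hhom : PositivelyHomogeneous F)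
    (hAB : IsDifferenceOfNonneg F ∨ SeparatelyBounded F) (hF : VanishesOnDisjoint F) :
    ∃ μ ν : Measure (UnitSphere n), IsFiniteMeasure μ ∧ IsFiniteMeasure ν ∧
      -- `ofRadialMap 1` is the unit ball. This formula recovers the integral of any nonnegative `f`
      -- from `F`, which transfers rotation invariance to `μ - ν`.
      (∀ f : C(UnitSphere n, ℝ≥0),
        F (Function.update (fun _ => ofRadialMap 1) ⟨0, hm⟩ (ofRadialMap f)) =
          ∫ u, (f u : ℝ) ∂μ - ∫ u, (f u : ℝ) ∂ν) ∧
      ∀ L : Fin m → StarBody n,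
        F L = ∫ u, ∏ i, (L i).radial u ∂μ - ∫ u, ∏ i, (L i).radial u ∂ν := by
  let G := radialForm F hadd hhom
  have hb := radialForm_separately_bounded F hadd hhom hAB
  obtain ⟨C, hC⟩ := hb 1 ⟨0, hm⟩
  obtain ⟨μ, ν, hμ, hν, h⟩ := exists_measures_integral_sub_integral
    (G.toLinearMap 1 ⟨0, hm⟩) hC
  refine ⟨μ, ν, hμ, hν, fun f => ?_, fun L => ?_⟩
  · rw [← h, MultilinearMap.toLinearMap_apply, radialForm_apply]
    congr 1
    ext1 k
    exact (Function.apply_update (fun _ => ofRadialMap)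
      (1 : Fin m → C(UnitSphere n, ℝ≥0)) _ f k).symm
  · rw [eq_radialForm F hadd hhom, apply_eq_apply_update_prod (radialForm F hadd hhom) hb
      (radialForm_eq_zero hadd hhom hF) _ ⟨0, hm⟩]
    refine (h (∏ k, (L k).radialMap)).trans ?_
    simp [ContinuousMap.prod_apply]

theorem VanishesOnDisjoint.hasMeasureRepresentation (hm : 1 ≤ m) {F : (Fin m → StarBody n) → ℝ}
    (hadd : SeparatelyAdditive F) (hhom : PositivelyHomogeneous F)
    (hAB : IsDifferenceOfNonneg F ∨ SeparatelyBounded F) (hF : VanishesOnDisjoint F) :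
    HasMeasureRepresentation F := by
  obtain ⟨μ, ν, hμ, hν, -, h⟩ := hF.exists_measures hm hadd hhom hAB
  have := isFiniteMeasure_totalVariation (μ.toSignedMeasure - ν.toSignedMeasure)
  refine ⟨μ.toSignedMeasure - ν.toSignedMeasure, inferInstance, fun L => ?_⟩
  rw [integral_toSignedMeasure_sub μ ν (continuous_prod_radial L), h]

theorem VanishesOnDisjoint.exists_eq_mul_dualMixedVolume (hm : 1 ≤ m) (hn : 2 ≤ n)
    {F : (Fin m → StarBody n) → ℝ} (hadd : SeparatelyAdditive F) (hhom : PositivelyHomogeneous F)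
    (hAB : IsDifferenceOfNonneg F ∨ SeparatelyBounded F) (hF : VanishesOnDisjoint F)
    (hrot : IsRotationInvariant F) :
    ∃ c : ℝ, ∀ L : Fin m → StarBody n, F L = c * dualMixedVolume L := by
  obtain ⟨μ, ν, hμ, hν, h1, h⟩ := hF.exists_measures hm hadd hhom hAB
  obtain ⟨c, hc⟩ := exists_integral_sub_integral_eq_mul_toSphere hn μ ν (fun φ hφ f hf h0 => by
    let g : C(UnitSphere n, ℝ≥0) := realToNN ⟨f, hf⟩
    let g' : C(UnitSphere n, ℝ≥0) := g.comp ⟨sphereMap φ.symm, continuous_sphereMap φ.symm⟩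
    have hg : ∀ u, (g u : ℝ) = f u := fun u => Real.coe_toNNReal _ (h0 u)
    have e1 := h1 g
    have e2 := h1 g'
    have e3 : ∀ u, (g' u : ℝ) = f (sphereMap φ.symm u) := fun u => hg _
    simp only [hg] at e1
    simp only [e3] at e2
    -- `φ` fixes the unit balls and takes the body with radial function `g` to the one with radial
    -- function `g'`.
    rw [← e1, ← e2, ← hrot φ hφ (Function.update _ _ (ofRadialMap g))]
    congr 1
    ext1 k
    apply radial_injective
    ext u
    rw [radial_map]
    by_cases hk : k = ⟨0, hm⟩
    · subst hk
      simp [e3, hg]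
    · simp [Function.update_of_ne hk])
  -- The factor `n` compensates the `1 / n` in `dualMixedVolume`.
  refine ⟨c * n, fun L => ?_⟩
  have hn0 : (n : ℝ) ≠ 0 := by positivity
  rw [h, hc _ (continuous_prod_radial L), dualMixedVolume]
  field_simp

end Bridge

theorem mainTheorem1 {n m : ℕ} (hn : 1 ≤ n) (hm : 1 ≤ m)
    (F : (Fin m → StarBody n) → ℝ)
    (hadd : SeparatelyAdditive F) (hhom : PositivelyHomogeneous F)
    (hAB : IsDifferenceOfNonneg F ∨ SeparatelyBounded F) :
    List.TFAE
      [VanishesOnDisjoint F,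
       IsSymmetricFunctional F ∧ IsOrthogonallyAdditive (associatedPolynomial F),
       HasMeasureRepresentation F] ∧
    (2 ≤ n → VanishesOnDisjoint F → IsRotationInvariant F →
      ∃ c : ℝ, ∀ L : Fin m → StarBody n, F L = c * dualMixedVolume L) := by
  refine ⟨?_, fun hn2 hF hrot =>
    hF.exists_eq_mul_dualMixedVolume hm hn2 hadd hhom hAB hrot⟩
  tfae_have 1 → 3 := fun hF => hF.hasMeasureRepresentation hm hadd hhom hAB
  tfae_have 3 → 2 := fun h => ⟨.of_hasMeasureRepresentation h, .of_hasMeasureRepresentation hm h⟩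
  tfae_have 2 → 1 := fun h => .of_isSymmetricFunctional hadd hhom hAB h.1 h.2
  tfae_finish
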